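/- Let $d\ge 1$ and let $f_1,\dots,f_J:\mathbb{R}^d\to\mathbb{R}^d$ be contracting similarities: there are $\tau_j\in(0,1)$ with $|f_j(x)-f_j(y)|=\tau_j|x-y|$ for all $j$ and all $x,y\in\mathbb{R}^d$, where $|\cdot|$ is either the supremum norm or the Euclidean norm (the same for all $j$). Assume $f_j(\mathbb{Q}^d)\subseteq\mathbb{Q}^d$ for every $j$. Let $C\subseteq\mathbb{R}^d$ be the attractor, that is, the unique nonempty compact set with $C=\bigcup_{j=1}^J f_j(C)$. Let $\|\cdot\|$ denote the supremum norm on $\mathbb{R}^d$. Assume that at least one of the following holds. (a) There is a nonempty bounded open set $O\subseteq\mathbb{R}^d$ with $f_j(O)\subseteq O$ for all $j$ and $f_i(O)\cap f_j(O)=\emptyset$ for $i\ne j$ (open set condition), and there is a nonzero vector $v\in\mathbb{Z}^d$ such that $C$ contains no non-degenerate line segment parallel to $v$. (b) $D<1/2$, where $D=-\dfrac{\log J}{\log\tau}$ and $\tau=\max_{1\le j\le J}\tau_j$. Then the following hold. 1. There is a constant $K>0$ such that for every $\xi\in C$ and every real $Q>1$ there is a rational vector $p/q\in\mathbb{Q}^d\setminus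 C$, with $p\in\mathbb{Z}^d$ and $q\in\mathbb{N}$, $1\le q\le Q$, such that $\|\xi-p/q\|\le K/Q$. Assume moreover that $C$ has more than one point. Then also: 2. For every function $\Phi:\mathbb{N}\to(0,\infty)$ with $\Phi(Q)\to 0$ as $Q\to\infty$ there is $\xi\in C\setminus\mathbb{Q}^d$ such that, for infinitely many $Q\in\mathbb{N}$, every $p/q\in\mathbb{Q}^d\setminus C$ with $p\in\mathbb{Z}^d$ and $1\le q\le Q$ satisfies $\|\xi-p/q\|>\Phi(Q)/Q$. 3. For every function $\Psi:\mathbb{N}\to(0,\infty)$ there is an intrinsically $\Psi$-approximable vector $\xi\in C$, that is, infinitely many rational vectors $p/q\in\mathbb{Q}^d\cap C$, written in lowest terms ($q\ge1$, $\gcd(p_1,\dots,p_d,q)=1$), satisfy $\|\xi-p/q\|<\Psi(q)$. 4. In particular, $C$ contains a Liouville vector, that is, a vector $\xi\in C\setminus\mathbb{Q}^d$ such that for every $N\in\mathbb{N}$ infinitely many rational vectors $p/q\in\mathbb{Q}^d$, written in lowest terms, satisfy $\|\xi-p/q\|<q^{-N}$. -/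

import Mathlib

open Filter Topology

noncomputable section

namespace CantorApprox

/-! The space `ℝ^d` is `Fin d → ℝ`, whose norm in Mathlib is the supremum norm. -/

/-- The rational points `ℚ^d ⊆ ℝ^d`. -/
def ratPoints (d : ℕ) : Set (Fin d → ℝ) :=
  Set.range fun (x : Fin d → ℚ) (i : Fin d) => (x i : ℝ)

/-- The rational vector `p / q` with numerator `p ∈ ℤ^d` and common denominator `q`
(used only for `1 ≤ q`). -/
def ratVec {d : ℕ} (p : Fin d → ℤ) (q : ℕ) : Fin d → ℝ :=
  fun i => (p i : ℝ) / (q : ℝ)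

/-- `p / q` is in lowest terms: `q ≥ 1` and `gcd (p₁, …, p_d, q) = 1`. -/
def IsReduced {d : ℕ} (p : Fin d → ℤ) (q : ℕ) : Prop :=
  1 ≤ q ∧ ∀ n : ℕ, n ∣ q → (∀ i, (n : ℤ) ∣ p i) → n = 1

/-- The iterated function system consists of contracting similarities with ratios
`τ_j ∈ (0, 1)`: `f_j` multiplies all distances by `τ_j`, where distances are measured either in
the supremum norm (for all `j`) or in the Euclidean norm (for all `j`) of `ℝ^d`. -/
def IsSimilarityIFS {d J : ℕ} (f : Fin J → (Fin d → ℝ) → (Fin d → ℝ)) (τ : Fin J → ℝ) : Prop :=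
  (∀ j, 0 < τ j ∧ τ j < 1) ∧
    ((∀ j x y, ‖f j x - f j y‖ = τ j * ‖x - y‖) ∨
      (∀ j x y, ‖WithLp.toLp 2 (f j x - f j y)‖ = τ j * ‖WithLp.toLp 2 (x - y)‖))

/-- The iterated function system is rational-preserving: `f_j (ℚ^d) ⊆ ℚ^d` for every `j`. -/
def IsRationalPreserving {d J : ℕ} (f : Fin J → (Fin d → ℝ) → (Fin d → ℝ)) : Prop :=
  ∀ j, Set.MapsTo (f j) (ratPoints d) (ratPoints d)

/-- `C` is the attractor of the iterated function system: the (unique) nonempty compact set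
with `⋃ j, f_j (C) = C`. -/
def IsAttractor {d J : ℕ} (f : Fin J → (Fin d → ℝ) → (Fin d → ℝ))
    (C : Set (Fin d → ℝ)) : Prop :=
  C.Nonempty ∧ IsCompact C ∧ (⋃ j, f j '' C) = C

/-- The open set condition. -/
def OpenSetCondition {d J : ℕ} (f : Fin J → (Fin d → ℝ) → (Fin d → ℝ)) : Prop :=
  ∃ O : Set (Fin d → ℝ), O.Nonempty ∧ IsOpen O ∧ Bornology.IsBounded O ∧
    (∀ j, f j '' O ⊆ O) ∧ ∀ i j, i ≠ j → Disjoint (f i '' O) (f j '' O)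

/-- `C` contains a (non-degenerate) line segment parallel to `v`; used only for `v ≠ 0`. -/
def ContainsSegmentParallel {d : ℕ} (C : Set (Fin d → ℝ)) (v : Fin d → ℝ) : Prop :=
  ∃ x : Fin d → ℝ, ∃ t : ℝ, 0 < t ∧ segment ℝ x (x + t • v) ⊆ C

/-- The quantity `D = - log J / log τ` with `τ = max_j τ_j`. -/
def similarityBound {J : ℕ} (τ : Fin J → ℝ) : ℝ :=
  -Real.log (J : ℝ) / Real.log (⨆ j, τ j)

/-- `ξ` is intrinsically `Ψ`-approximable with respect to `C`: it lies in `C` and infinitely many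
rational vectors `p / q ∈ C`, written in lowest terms, satisfy `‖ξ - p / q‖ < Ψ q`. -/
def IntrinsicallyApproximable {d : ℕ} (C : Set (Fin d → ℝ)) (Ψ : ℕ → ℝ)
    (ξ : Fin d → ℝ) : Prop :=
  ξ ∈ C ∧ {r : (Fin d → ℤ) × ℕ | IsReduced r.1 r.2 ∧ ratVec r.1 r.2 ∈ C ∧
    ‖ξ - ratVec r.1 r.2‖ < Ψ r.2}.Infinite

/-- `ξ` is a Liouville vector: it is irrational and, for every `N`, infinitely many rational
vectors `p / q`, written in lowest terms, satisfy `‖ξ - p / q‖ < q ^ (-N)`. -/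
def IsLiouvilleVector {d : ℕ} (ξ : Fin d → ℝ) : Prop :=
  ξ ∉ ratPoints d ∧ ∀ N : ℕ, {r : (Fin d → ℤ) × ℕ | IsReduced r.1 r.2 ∧
    ‖ξ - ratVec r.1 r.2‖ < ((r.2 : ℝ) ^ N)⁻¹}.Infinite

end CantorApprox

end

noncomputable section

namespace CantorApprox

open MeasureTheory Set
open scoped Pointwise

/-! Extrinsic bound under (a). The segment condition forces `C` to have empty interior. If `∑ τ_j ^
d ≥ 1`, the disjoint images of the open set would fill it up to a null set and contraction would put
it inside `C`; hence `∑ τ_j ^ d < 1` and `C` is null. Since a ball of radius `r` meets boundedly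
many pieces of size `r`, nullness upgrades to porosity (`exists_hole`): the ball contains a hole of
radius `δ * r`. At scale `r ≍ 1 / n` the hole contains a point of the grid `n⁻¹ ℤ^d`.

Extrinsic bound under (b). Each prime `q` in `(√n, n]` gives a rational vector of denominator `q *
(n / q)` within `2 / n` of `ξ`, and different primes give points at least `1 / n ^ 2` apart. If all
lay in `C`, they would lie in different pieces of a level `k` at which pieces have diameter below `1
/ n ^ 2`. There are `J ^ k ≲ n ^ (2 * D)` such pieces, fewer than the primes because `2 * D < 1`.

Remaining claims. Linear algebra over `ℚ` gives each map a rational fixed point, which lies in `C`;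
its images under compositions are dense in `C`, and `C` has no isolated point unless it is a
singleton. Baire's theorem in `C` (`exists_irrational_close`) then gives irrational points
arbitrarily well approximated by rational points of `C`. Such proximity repels every rational vector
off `C`, because distinct `p / q` and `p₀ / q₀` are at least `1 / (q * q₀)` apart. -/

/-- A distance-preserving self-map of a proper normed group fixing the origin is onto. -/
theorem surjective_of_isometry {E : Type*} [NormedAddCommGroup E] [ProperSpace E] {φ : E → E}
    (hφ : Isometry φ) (h0 : φ 0 = 0) : Function.Surjective φ := by
  intro y
  have hcl : IsClosed (range φ) := hφ.isClosedEmbedding.isClosed_range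
  change y ∈ range φ
  rw [← hcl.closure_eq, Metric.mem_closure_range_iff]
  intro ε hε
  have hit : ∀ n, Isometry (φ^[n]) := fun n => by
    induction n with
    | zero => exact isometry_id
    | succ n ih => rw [Function.iterate_succ]; exact ih.comp hφ
  have hb : ∀ n, φ^[n] y ∈ Metric.closedBall (0 : E) ‖y‖ := fun n => by
    have h1 : φ^[n] 0 = 0 := Function.iterate_fixed h0 n
    have := (hit n).dist_eq y 0
    rw [h1] at this
    simp [← dist_zero_right, this]
  -- Two iterates in the bounded orbit of `y` are within `ε`; cancelling the common isometry `φ^[u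
  -- N]` puts a point of the range within `ε` of `y`.
  obtain ⟨a, -, u, hu, ha⟩ := (isCompact_closedBall (0 : E) ‖y‖).tendsto_subseq hb
  obtain ⟨N, hN⟩ := Metric.cauchySeq_iff.1 ha.cauchySeq ε hε
  have hlt : u N < u (N + 1) := hu (Nat.lt_succ_self N)
  have h := hN N le_rfl (N + 1) (Nat.le_succ N)
  obtain ⟨m, hm⟩ := Nat.exists_eq_add_of_lt hlt
  simp only [Function.comp_apply] at h
  rw [hm, add_assoc, Function.iterate_add_apply, (hit (u N)).dist_eq,
    Function.iterate_succ_apply'] at h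
  exact ⟨_, h⟩

/-! ### Similarities and cylinder pieces -/

section Similarity

variable {d : ℕ} {E : Type*} [NormedAddCommGroup E] [NormedSpace ℝ E]

/-- `g` multiplies by `ρ` the distances of the norm transported to `ℝ^d` along `e`. -/
def IsSim (e : E ≃L[ℝ] (Fin d → ℝ)) (ρ : ℝ) (g : (Fin d → ℝ) → (Fin d → ℝ)) : Prop :=
  ∀ x y, ‖e.symm (g x - g y)‖ = ρ * ‖e.symm (x - y)‖

variable {e : E ≃L[ℝ] (Fin d → ℝ)} {ρ ρ' : ℝ} {g g' : (Fin d → ℝ) → (Fin d → ℝ)}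

theorem isSim_id : IsSim e 1 id := fun x y => by simp

theorem IsSim.comp (h : IsSim e ρ g) (h' : IsSim e ρ' g') : IsSim e (ρ * ρ') (g ∘ g') :=
  fun x y => by rw [Function.comp_apply, Function.comp_apply, h, h', mul_assoc]

theorem IsSim.injective (h : IsSim e ρ g) (hρ : 0 < ρ) : Function.Injective g := fun x y hxy => by
  have := h x y
  rw [hxy, sub_self, map_zero, norm_zero, eq_comm, mul_eq_zero] at this
  have := this.resolve_left hρ.ne'
  rwa [norm_eq_zero, map_eq_zero_iff _ e.symm.injective, sub_eq_zero] at this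

/-- The distortion between the supremum norm and the norm transported along `e`. -/
def distortion (e : E ≃L[ℝ] (Fin d → ℝ)) : ℝ :=
  ‖(e : E →L[ℝ] (Fin d → ℝ))‖ * ‖(e.symm : (Fin d → ℝ) →L[ℝ] E)‖ + 1

theorem distortion_pos : 0 < distortion e := by unfold distortion; positivity

theorem IsSim.norm_sub_le (h : IsSim e ρ g) (hρ : 0 ≤ ρ) (x y : Fin d → ℝ) :
    ‖g x - g y‖ ≤ distortion e * ρ * ‖x - y‖ := by
  have h1 : ‖g x - g y‖ ≤ ‖(e : E →L[ℝ] (Fin d → ℝ))‖ * ‖e.symm (g x - g y)‖ := by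
    simpa using (e : E →L[ℝ] (Fin d → ℝ)).le_opNorm (e.symm (g x - g y))
  have h2 : ‖e.symm (x - y)‖ ≤ ‖(e.symm : (Fin d → ℝ) →L[ℝ] E)‖ * ‖x - y‖ :=
    (e.symm : (Fin d → ℝ) →L[ℝ] E).le_opNorm (x - y)
  rw [h] at h1
  calc ‖g x - g y‖ ≤ ‖(e : E →L[ℝ] (Fin d → ℝ))‖ * (ρ * ‖e.symm (x - y)‖) := h1
    _ ≤ ‖(e : E →L[ℝ] (Fin d → ℝ))‖ * (ρ * (‖(e.symm : (Fin d → ℝ) →L[ℝ] E)‖ * ‖x - y‖)) := by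
        gcongr
    _ ≤ distortion e * ρ * ‖x - y‖ := by
        unfold distortion
        nlinarith [mul_nonneg hρ (norm_nonneg (x - y))]

theorem IsSim.continuous (h : IsSim e ρ g) (hρ : 0 ≤ ρ) : Continuous g :=
  (LipschitzWith.of_dist_le_mul (K := (distortion e * ρ).toNNReal) fun x y => by
    rw [dist_eq_norm, dist_eq_norm, Real.coe_toNNReal _ (mul_nonneg distortion_pos.le hρ)]
    exact h.norm_sub_le hρ x y).continuous

/-- A similarity of `ℝ^d` is affine. -/
theorem IsSim.exists_linear (h : IsSim e ρ g) (hρ : 0 < ρ) :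
    ∃ L : (Fin d → ℝ) →ₗ[ℝ] (Fin d → ℝ), ∀ x, g x = L x + g 0 := by
  have : FiniteDimensional ℝ E := e.symm.toLinearEquiv.finiteDimensional
  have : ProperSpace E := FiniteDimensional.proper_real E
  -- Conjugated and rescaled, `g` is an isometry fixing the origin; being onto, it is linear by the
  -- Mazur–Ulam theorem.
  let φ : E → E := fun x => ρ⁻¹ • e.symm (g (e x) - g 0)
  have h0 : φ 0 = 0 := by simp [φ]
  have hφ : Isometry φ := Isometry.of_dist_eq fun x y => by
    rw [dist_eq_norm, dist_eq_norm, ← smul_sub, norm_smul, ← map_sub, sub_sub_sub_cancel_right, h,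
      ← map_sub, e.symm_apply_apply, Real.norm_of_nonneg (inv_nonneg.2 hρ.le),
      inv_mul_cancel_left₀ hρ.ne']
  let Φ : E ≃ᵢ E := IsometryEquiv.mk (Equiv.ofBijective φ ⟨hφ.injective,
    surjective_of_isometry hφ h0⟩) hφ
  let M : E ≃ₗᵢ[ℝ] E := Φ.toRealLinearIsometryEquivOfMapZero h0
  have hM : ∀ x, M x = φ x := fun x => rfl
  refine ⟨ρ • ((e : E →ₗ[ℝ] (Fin d → ℝ)) ∘ₗ (M.toLinearEquiv : E →ₗ[ℝ] E) ∘ₗ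
    (e.symm : (Fin d → ℝ) →ₗ[ℝ] E)), fun x => ?_⟩
  have : M (e.symm x) = ρ⁻¹ • e.symm (g x - g 0) := by
    change ρ⁻¹ • e.symm (g (e (e.symm x)) - g 0) = _
    rw [e.apply_symm_apply]
  change g x = ρ • e (M (e.symm x)) + g 0
  rw [this, map_smul, smul_inv_smul₀ hρ.ne', e.apply_symm_apply]
  exact (sub_add_cancel (g x) (g 0)).symm

/-- A similarity with ratio `ρ` multiplies the volume by `ρ ^ d`. -/
theorem IsSim.volume_image (h : IsSim e ρ g) (hρ : 0 < ρ) (s : Set (Fin d → ℝ)) :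
    volume (g '' s) = ENNReal.ofReal (ρ ^ d) * volume s := by
  obtain ⟨L, hL⟩ := h.exists_linear hρ
  have himg : ∀ s : Set (Fin d → ℝ), volume (g '' s) =
      ENNReal.ofReal |LinearMap.det L| * volume s := fun s => by
    rw [← Measure.addHaar_image_linearMap, ← measure_preimage_add_right volume (- g 0) (L '' s)]
    congr 1
    ext y
    exact ⟨fun ⟨x, hx, h⟩ => ⟨x, hx, by rw [← h, hL x]; exact (add_neg_cancel_right _ _).symm⟩,
      fun ⟨x, hx, h⟩ => ⟨x, hx, by rw [hL x, h]; exact neg_add_cancel_right _ _⟩⟩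
  have hLn : ∀ x, ‖e.symm (L x)‖ = ρ * ‖e.symm x‖ := fun x => by
    have := h x 0
    rwa [hL x, add_sub_cancel_right, sub_zero] at this
  have hLi : Function.Injective L := by
    rw [← LinearMap.ker_eq_bot, LinearMap.ker_eq_bot']
    intro x hx
    have := hLn x
    rw [hx, map_zero, norm_zero, eq_comm, mul_eq_zero] at this
    simpa using this.resolve_left hρ.ne'
  have hLs : Function.Surjective L := LinearMap.surjective_of_injective hLi
  -- The unit ball of the transported norm satisfies `L '' B = ρ • B`, so comparing volumes gives
  -- `|det L| = ρ ^ d`.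
  let B : Set (Fin d → ℝ) := {x | ‖e.symm x‖ < 1}
  have hBo : IsOpen B := isOpen_lt (by fun_prop) continuous_const
  have hB0 : volume B ≠ 0 := (hBo.measure_pos volume ⟨0, by simp [B]⟩).ne'
  have hBb : Bornology.IsBounded B := by
    refine (Metric.isBounded_closedBall (x := (0 : Fin d → ℝ))
      (r := ‖(e : E →L[ℝ] (Fin d → ℝ))‖)).subset fun x hx => ?_
    rw [mem_closedBall_zero_iff]
    calc ‖x‖ ≤ ‖(e : E →L[ℝ] (Fin d → ℝ))‖ * ‖e.symm x‖ := by
          simpa using (e : E →L[ℝ] (Fin d → ℝ)).le_opNorm (e.symm x)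
      _ ≤ ‖(e : E →L[ℝ] (Fin d → ℝ))‖ * 1 := by gcongr; exact le_of_lt hx
      _ = _ := mul_one _
  have hLB : L '' B = ρ • B := by
    ext y
    rw [mem_smul_set_iff_inv_smul_mem₀ hρ.ne']
    obtain ⟨x, rfl⟩ := hLs y
    rw [hLi.mem_set_image]
    simp only [B, mem_ofPred_eq, map_smul, norm_smul, hLn,
      Real.norm_of_nonneg (inv_nonneg.2 hρ.le), inv_mul_cancel_left₀ hρ.ne']
  have key := Measure.addHaar_image_linearMap volume L B
  rw [hLB, Measure.addHaar_smul, Module.finrank_fin_fun, abs_of_nonneg (pow_nonneg hρ.le d),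
    ENNReal.mul_left_inj hB0 hBb.measure_lt_top.ne] at key
  rw [himg, key]

variable {J : ℕ} {f : Fin J → (Fin d → ℝ) → (Fin d → ℝ)} {τ : Fin J → ℝ}

/-- The attractor splits into pieces of comparable size `r`, coming from compositions of the maps
of the iterated function system. -/
theorem exists_pieces (hf : ∀ j, IsSim e (τ j) (f j)) {s t : ℝ} (ht : 0 < t) (hs : s < 1)
    (hτ : ∀ j, t ≤ τ j ∧ τ j ≤ s) {r : ℝ} (hr : 0 < r) :
    ∃ (ι : Type) (_ : Fintype ι) (g : ι → (Fin d → ℝ) → (Fin d → ℝ)) (ρ : ι → ℝ),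
      (∀ i, min 1 (t * r) ≤ ρ i ∧ ρ i ≤ r ∧ IsSim e (ρ i) (g i)) ∧
      (∀ S, (∀ j, MapsTo (f j) S S) → ∀ i, MapsTo (g i) S S) ∧
      (∀ C, (⋃ j, f j '' C) = C → C ⊆ ⋃ i, g i '' C) ∧
      (∀ O, (∀ j, MapsTo (f j) O O) → (∀ i j, i ≠ j → Disjoint (f i '' O) (f j '' O)) →
        Pairwise fun i i' => Disjoint (g i '' O) (g i' '' O)) := by
  rcases isEmpty_or_nonempty (Fin J) with hJ | ⟨⟨j₀⟩⟩
  · refine ⟨Empty, inferInstance, fun _ => id, fun _ => 1, fun i => i.elim, fun _ _ i => i.elim,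
      fun C hC => ?_, fun _ _ _ i => i.elim⟩
    rw [iUnion_of_empty] at hC
    simp [← hC]
  have hs0 : 0 < s := ht.trans_le ((hτ j₀).1.trans (hτ j₀).2)
  -- Subdivision stops at a piece once its remaining target size is at least `1`; the first map `f
  -- j` replaces `r` by `r / τ j`, and `n` bounds the depth. The `min 1` accounts for targets so
  -- large that the identity alone is used.
  obtain ⟨n, hn⟩ := exists_pow_lt_of_lt_one hr hs
  induction n generalizing r with
  | zero =>
    rw [pow_zero] at hn
    refine ⟨Unit, inferInstance, fun _ => id, fun _ => 1, fun _ => ⟨min_le_left _ _, hn.le,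
      isSim_id⟩, fun S _ _ => mapsTo_id S, fun C _ x hx => mem_iUnion.2 ⟨(), x, hx, rfl⟩,
        fun _ _ _ i i' h => (h rfl).elim⟩
  | succ n ih =>
    rcases le_or_gt 1 r with h1 | h1
    · refine ⟨Unit, inferInstance, fun _ => id, fun _ => 1, fun _ => ⟨min_le_left _ _, h1,
        isSim_id⟩, fun S _ _ => mapsTo_id S, fun C _ x hx => mem_iUnion.2 ⟨(), x, hx, rfl⟩,
        fun _ _ _ i i' h => (h rfl).elim⟩
    have hτ0 : ∀ j, 0 < τ j := fun j => ht.trans_le (hτ j).1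
    choose ι hι g ρ h1' h2 h3 h4 using fun j => ih (r := r / τ j) (div_pos hr (hτ0 j)) (by
      rw [lt_div_iff₀ (hτ0 j)]
      refine lt_of_le_of_lt ?_ hn
      rw [pow_succ]
      exact mul_le_mul_of_nonneg_left (hτ j).2 (pow_nonneg hs0.le n))
    refine ⟨Σ j, ι j, inferInstance, fun i => f i.1 ∘ g i.1 i.2, fun i => τ i.1 * ρ i.1 i.2,
      fun i => ⟨?_, ?_, (hf _).comp (h1' _ _).2.2⟩, fun S hS i => (hS _).comp (h2 _ S hS _),
      fun C hC x hx => ?_, ?_⟩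
    · refine (min_le_right _ _).trans ?_
      have := mul_le_mul_of_nonneg_left (h1' i.1 i.2).1 (hτ0 i.1).le
      refine le_trans ?_ this
      rw [mul_min_of_nonneg _ _ (hτ0 i.1).le]
      refine le_min ?_ (le_of_eq ?_)
      · nlinarith [(hτ i.1).1]
      · have := (hτ0 i.1).ne'
        field_simp
    · have := mul_le_mul_of_nonneg_left (h1' i.1 i.2).2.1 (hτ0 i.1).le
      rwa [mul_div_cancel₀ _ (hτ0 i.1).ne'] at this
    · rw [← hC] at hx
      obtain ⟨j, y, hy, rfl⟩ := mem_iUnion.1 hx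
      obtain ⟨i, z, hz, rfl⟩ := mem_iUnion.1 (h3 j C hC hy)
      exact mem_iUnion.2 ⟨⟨j, i⟩, z, hz, rfl⟩
    · rintro O hO hd ⟨j, i⟩ ⟨j', i'⟩ hne
      simp only [image_comp]
      by_cases hj : j = j'
      · subst hj
        exact disjoint_image_of_injective ((hf j).injective (hτ0 j))
          (h4 j O hO hd fun h => hne (by rw [h]))
      · exact (hd j j' hj).mono (image_mono (h2 j O hO i).image_subset)
          (image_mono (h2 j' O hO i').image_subset)

/-- The attractor is covered by `J ^ k` compositions of length `k`. -/
theorem exists_cover (hf : ∀ j, IsSim e (τ j) (f j)) {s : ℝ} (hτ : ∀ j, 0 ≤ τ j ∧ τ j ≤ s)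
    (k : ℕ) :
    ∃ g : (Fin k → Fin J) → (Fin d → ℝ) → (Fin d → ℝ),
      (∀ i, ∃ ρ, 0 ≤ ρ ∧ ρ ≤ s ^ k ∧ IsSim e ρ (g i)) ∧
      ∀ C, (⋃ j, f j '' C) = C → C ⊆ ⋃ i, g i '' C := by
  induction k with
  | zero =>
    exact ⟨fun _ => id, fun _ => ⟨1, zero_le_one, by simp, isSim_id⟩,
      fun C _ x hx => mem_iUnion.2 ⟨Fin.elim0, x, hx, rfl⟩⟩
  | succ k ih =>
    obtain ⟨g, hg, hc⟩ := ih
    refine ⟨fun i => f (i 0) ∘ g (Fin.tail i), fun i => ?_, fun C hC x hx => ?_⟩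
    · obtain ⟨ρ, h0, h1, h2⟩ := hg (Fin.tail i)
      refine ⟨τ (i 0) * ρ, mul_nonneg (hτ _).1 h0, ?_, (hf _).comp h2⟩
      rw [pow_succ']
      exact mul_le_mul (hτ _).2 h1 h0 ((hτ (i 0)).1.trans (hτ _).2)
    · rw [← hC] at hx
      obtain ⟨j, y, hy, rfl⟩ := mem_iUnion.1 hx
      obtain ⟨i, z, hz, rfl⟩ := mem_iUnion.1 (hc C hC hy)
      exact mem_iUnion.2 ⟨Fin.cons j i, z, hz, by simp [Fin.tail_cons]⟩

end Similarity

/-! ### Nullness and porosity under the open set condition -/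

section Porosity

variable {d : ℕ} {E : Type*} [NormedAddCommGroup E] [NormedSpace ℝ E]
  {e : E ≃L[ℝ] (Fin d → ℝ)} {ρ : ℝ} {g : (Fin d → ℝ) → (Fin d → ℝ)}

theorem IsSim.surjective (h : IsSim e ρ g) (hρ : 0 < ρ) : Function.Surjective g := by
  obtain ⟨L, hL⟩ := h.exists_linear hρ
  have hLi : Function.Injective L := fun x y hxy => h.injective hρ (by rw [hL x, hL y, hxy])
  intro y
  obtain ⟨x, hx⟩ := LinearMap.surjective_of_injective hLi (y - g 0)
  exact ⟨x, by rw [hL x, hx]; exact sub_add_cancel y (g 0)⟩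

theorem IsSim.le_norm_sub (h : IsSim e ρ g) (hρ : 0 < ρ) (x y : Fin d → ℝ) :
    ρ * ‖x - y‖ ≤ distortion e * ‖g x - g y‖ := by
  obtain ⟨k, hk⟩ := (Function.bijective_iff_has_inverse.1 ⟨h.injective hρ, h.surjective hρ⟩)
  have hsim : IsSim e ρ⁻¹ k := fun u v => by
    have := h (k u) (k v)
    rw [hk.2, hk.2] at this
    rw [this, inv_mul_cancel_left₀ hρ.ne']
  have := hsim.norm_sub_le (inv_nonneg.2 hρ.le) (g x) (g y)
  rw [hk.1, hk.1] at this
  calc ρ * ‖x - y‖ ≤ ρ * (distortion e * ρ⁻¹ * ‖g x - g y‖) := by gcongr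
    _ = distortion e * ‖g x - g y‖ := by field_simp

theorem IsSim.measurableSet_image (h : IsSim e ρ g) (hρ : 0 < ρ) {s : Set (Fin d → ℝ)}
    (hs : MeasurableSet s) : MeasurableSet (g '' s) :=
  hs.image_of_continuousOn_injOn (h.continuous hρ.le).continuousOn (h.injective hρ).injOn

variable {J : ℕ} {f : Fin J → (Fin d → ℝ) → (Fin d → ℝ)} {τ : Fin J → ℝ}
  {C O : Set (Fin d → ℝ)}

/-- Under the open set condition, if the ratios satisfy `∑ τ_j ^ d ≥ 1`, then the open set is
contained in the attractor. -/
theorem subset_attractor_of_one_le_sum (hf : ∀ j, IsSim e (τ j) (f j)) {s : ℝ} (hs : s < 1)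
    (hτ : ∀ j, 0 < τ j ∧ τ j ≤ s) (hC : IsAttractor f C) (hO : IsOpen O)
    (hOb : Bornology.IsBounded O) (hfO : ∀ j, MapsTo (f j) O O)
    (hd : ∀ i j, i ≠ j → Disjoint (f i '' O) (f j '' O))
    (hsum : 1 ≤ ∑ j, ENNReal.ofReal (τ j ^ d)) : O ⊆ C := by
  obtain ⟨hCn, hCc, hCf⟩ := hC
  have hfC : ∀ j, MapsTo (f j) C C := fun j x hx => by
    rw [← hCf]
    exact mem_iUnion.2 ⟨j, mem_image_of_mem _ hx⟩
  let U := ⋃ j, f j '' O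
  have hUO : U ⊆ O := iUnion_subset fun j => (hfO j).image_subset
  have hUm : MeasurableSet U := MeasurableSet.iUnion fun j =>
    (hf j).measurableSet_image (hτ j).1 hO.measurableSet
  have hUv : volume O ≤ volume U := by
    rw [measure_iUnion (fun i j hij => hd i j hij) fun j =>
      (hf j).measurableSet_image (hτ j).1 hO.measurableSet, tsum_fintype]
    simp only [(hf _).volume_image (hτ _).1, ← Finset.sum_mul]
    exact le_mul_of_one_le_left zero_le hsum
  have hnull : volume (O \ U) = 0 := by
    rw [measure_sdiff hUO hUm.nullMeasurableSet
      ((measure_mono hUO).trans_lt hOb.measure_lt_top).ne]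
    exact tsub_eq_zero_of_le hUv
  have hdense : O ⊆ closure U := fun x hx => by
    rw [mem_closure_iff]
    intro V hV hxV
    by_contra hne
    have h0 : 0 < volume (V ∩ O) := (hV.inter hO).measure_pos volume ⟨x, hxV, hx⟩
    have hsub : V ∩ O ⊆ O \ U := fun y hy => ⟨hy.2, fun hyU => hne ⟨y, hy.1, hyU⟩⟩
    exact h0.ne' (measure_mono_null hsub hnull)
  -- Distances are measured in `E`, where `f j` contracts by exactly `τ j`; in the supremum norm the
  -- distortion could spoil the contraction.
  let D : Set E := e.symm '' C
  have hDn : D.Nonempty := hCn.image _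
  have hDc : IsCompact D := hCc.image e.symm.continuous
  have hcontract : ∀ j y, Metric.infDist (e.symm (f j y)) D ≤
      τ j * Metric.infDist (e.symm y) D := fun j y => by
    obtain ⟨z, ⟨c, hc, rfl⟩, hz⟩ := hDc.exists_infDist_eq_dist hDn (e.symm y)
    rw [hz, dist_eq_norm, ← map_sub, ← hf j, map_sub, ← dist_eq_norm]
    exact Metric.infDist_le_dist_of_mem (mem_image_of_mem _ (hfC j hc))
  have hcont : Continuous fun x => Metric.infDist (e.symm x) D :=
    (Metric.continuous_infDist_pt D).comp e.symm.continuous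
  -- A bound `M` on `O` improves to `s * M` on the images of `O`, hence on `O` by density. Iteration
  -- forces the distance to vanish.
  have hstep : ∀ M, 0 ≤ M → (∀ x ∈ O, Metric.infDist (e.symm x) D ≤ M) →
      ∀ x ∈ O, Metric.infDist (e.symm x) D ≤ s * M := fun M hM0 hM x hx => by
    refine closure_minimal (s := U) (t := {x | Metric.infDist (e.symm x) D ≤ s * M}) ?_
      (isClosed_le hcont continuous_const) (hdense hx)
    rintro z hz
    obtain ⟨j, y, hy, rfl⟩ := mem_iUnion.1 hz
    exact (hcontract j y).trans (mul_le_mul (hτ j).2 (hM y hy) Metric.infDist_nonneg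
      ((hτ j).1.le.trans (hτ j).2))
  intro x hx
  have hs0 : 0 ≤ s := by
    obtain ⟨c, hc⟩ := hCn
    rw [← hCf] at hc
    obtain ⟨j, -⟩ := mem_iUnion.1 hc
    exact (hτ j).1.le.trans (hτ j).2
  obtain ⟨M, hM⟩ : ∃ M, ∀ x ∈ O, Metric.infDist (e.symm x) D ≤ M := by
    obtain ⟨M, hM⟩ := (hOb.isCompact_closure.image hcont).bddAbove
    exact ⟨M, fun y hy => hM (mem_image_of_mem _ (subset_closure hy))⟩
  have hM0 : 0 ≤ M := Metric.infDist_nonneg.trans (hM x hx)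
  have hpow : ∀ n : ℕ, ∀ x ∈ O, Metric.infDist (e.symm x) D ≤ s ^ n * M := fun n => by
    induction n with
    | zero => simpa using hM
    | succ n ih =>
      rw [pow_succ', mul_assoc]
      exact hstep _ (by positivity) ih
  have hlim : Tendsto (fun n : ℕ => s ^ n * M) atTop (𝓝 0) := by
    simpa using (tendsto_pow_atTop_nhds_zero_of_lt_one hs0 hs).mul_const M
  have hzero : Metric.infDist (e.symm x) D = 0 :=
    le_antisymm (ge_of_tendsto' hlim fun n => hpow n x hx) Metric.infDist_nonneg
  obtain ⟨c, hc, hcx⟩ := (hDc.isClosed.mem_iff_infDist_zero hDn).2 hzero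
  rwa [← e.symm.injective hcx]

/-- Under the open set condition, an attractor with empty interior is a null set. -/
theorem volume_attractor_eq_zero (hf : ∀ j, IsSim e (τ j) (f j)) {s : ℝ} (hs : s < 1)
    (hτ : ∀ j, 0 < τ j ∧ τ j ≤ s) (hC : IsAttractor f C) (hCi : interior C = ∅)
    (hO : IsOpen O) (hOn : O.Nonempty)
    (hOb : Bornology.IsBounded O) (hfO : ∀ j, MapsTo (f j) O O)
    (hd : ∀ i j, i ≠ j → Disjoint (f i '' O) (f j '' O)) : volume C = 0 := by
  have hsum : ∑ j, ENNReal.ofReal (τ j ^ d) < 1 := by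
    by_contra! h
    obtain ⟨x, hx⟩ := hOn
    have : x ∈ interior C :=
      mem_interior.2 ⟨O, subset_attractor_of_one_le_sum hf hs hτ hC hO hOb hfO hd h, hO, hx⟩
    rwa [hCi] at this
  have hle : volume C ≤ (∑ j, ENNReal.ofReal (τ j ^ d)) * volume C := by
    conv_lhs => rw [← hC.2.2]
    refine (measure_iUnion_fintype_le _ _).trans (le_of_eq ?_)
    simp only [(hf _).volume_image (hτ _).1, Finset.sum_mul]
  by_contra h0
  have := ENNReal.mul_lt_mul_left h0 hC.2.1.measure_lt_top.ne hsum
  rw [one_mul] at this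
  exact absurd hle (not_le.2 this)

/-- Under the open set condition, a ball of radius `r` meets a bounded number of pieces of
size `r`. -/
theorem exists_card_pieces_le {t : ℝ} (ht : 0 < t) (hO : IsOpen O) (hOn : O.Nonempty)
    (hb : Bornology.IsBounded (C ∪ O)) :
    ∃ N : ℕ, ∀ (ι : Type) [Fintype ι] (g : ι → (Fin d → ℝ) → (Fin d → ℝ)) (ρ : ι → ℝ) (r : ℝ)
      (x : Fin d → ℝ), 0 < r → (∀ i, t * r ≤ ρ i ∧ ρ i ≤ r ∧ IsSim e (ρ i) (g i)) →
      (Pairwise fun i i' => Disjoint (g i '' O) (g i' '' O)) →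
      (∀ i, ∃ u ∈ C, ‖g i u - x‖ < r) → Fintype.card ι ≤ N := by
  obtain ⟨R, hR⟩ := Metric.isBounded_iff.1 hb
  have hR0 : 0 ≤ R := by
    obtain ⟨o, ho⟩ := hOn
    exact dist_nonneg.trans (hR (Or.inr ho) (Or.inr ho))
  -- A piece meeting the ball has `g i '' O` within `distortion e * r * R + r = c * r` of `x`.
  -- Disjoint sets of volume at least `(t * r) ^ d * volume O` then share one ball of radius `c *
  -- r`, and `r` cancels.
  set c : ℝ := distortion e * R + 1 with hc
  have hc0 : 0 < c := by have := distortion_pos (e := e); positivity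
  have hv0 : volume O ≠ 0 := (hO.measure_pos volume hOn).ne'
  have hvt : volume O ≠ ⊤ := (hb.subset subset_union_right).measure_lt_top.ne
  have ht0 : ENNReal.ofReal (t ^ d) * volume O ≠ 0 :=
    mul_ne_zero (ENNReal.ofReal_pos.2 (pow_pos ht d)).ne' hv0
  have htt : ENNReal.ofReal (t ^ d) * volume O ≠ ⊤ := ENNReal.mul_ne_top ENNReal.ofReal_ne_top hvt
  set V := volume (Metric.closedBall (0 : Fin d → ℝ) 1)
  have hV : V ≠ ⊤ := measure_closedBall_lt_top.ne
  obtain ⟨N, hN⟩ := ENNReal.exists_nat_gt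
    (ENNReal.div_ne_top (ENNReal.mul_ne_top (ENNReal.ofReal_ne_top (r := c ^ d)) hV) ht0)
  refine ⟨N, fun ι _ g ρ r x hr hg hdis hx => ?_⟩
  have hρ : ∀ i, 0 < ρ i := fun i => (mul_pos ht hr).trans_le (hg i).1
  have hsub : (⋃ i, g i '' O) ⊆ Metric.closedBall x (c * r) := by
    refine iUnion_subset fun i => ?_
    rintro _ ⟨o, ho, rfl⟩
    obtain ⟨u, hu, hux⟩ := hx i
    have h1 := (hg i).2.2.norm_sub_le (hρ i).le o u
    have h2 : ‖o - u‖ ≤ R := by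
      rw [← dist_eq_norm]
      exact hR (Or.inr ho) (Or.inl hu)
    have h3 : distortion e * ρ i * ‖o - u‖ ≤ distortion e * r * R := by
      have := distortion_pos (e := e)
      have := (hρ i).le
      gcongr
      exact (hg i).2.1
    rw [mem_closedBall_iff_norm]
    calc ‖g i o - x‖ = ‖(g i o - g i u) + (g i u - x)‖ := by rw [sub_add_sub_cancel]
      _ ≤ ‖g i o - g i u‖ + ‖g i u - x‖ := norm_add_le _ _
      _ ≤ c * r := by rw [hc]; nlinarith
  have hmeas : (Fintype.card ι : ENNReal) * (ENNReal.ofReal ((t * r) ^ d) * volume O) ≤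
      ENNReal.ofReal ((c * r) ^ d) * V := by
    calc (Fintype.card ι : ENNReal) * (ENNReal.ofReal ((t * r) ^ d) * volume O)
        = ∑ i : ι, ENNReal.ofReal ((t * r) ^ d) * volume O := by
          rw [Finset.sum_const, Finset.card_univ, nsmul_eq_mul]
      _ ≤ ∑ i, volume (g i '' O) := Finset.sum_le_sum fun i _ => by
          rw [(hg i).2.2.volume_image (hρ i)]
          gcongr
          exact (hg i).1
      _ = volume (⋃ i, g i '' O) := by
          rw [measure_iUnion hdis fun i =>
            (hg i).2.2.measurableSet_image (hρ i) hO.measurableSet, tsum_fintype]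
      _ ≤ volume (Metric.closedBall x (c * r)) := measure_mono hsub
      _ = ENNReal.ofReal ((c * r) ^ d) * V := by
          rw [Measure.addHaar_closedBall' _ _ (by positivity), Module.finrank_fin_fun]
  have hrd : ENNReal.ofReal (r ^ d) ≠ 0 := (ENNReal.ofReal_pos.2 (pow_pos hr d)).ne'
  rw [mul_pow, mul_pow, ENNReal.ofReal_mul (by positivity), ENNReal.ofReal_mul (by positivity),
    mul_right_comm (ENNReal.ofReal (t ^ d)), mul_right_comm (ENNReal.ofReal (c ^ d)), ← mul_assoc,
    ENNReal.mul_le_mul_iff_left hrd ENNReal.ofReal_ne_top] at hmeas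
  have := (ENNReal.le_div_iff_mul_le (Or.inl ht0) (Or.inl htt)).2 hmeas
  exact_mod_cast (this.trans_lt hN).le

/-- Under the open set condition, an attractor with empty interior is porous. -/
theorem exists_hole (hf : ∀ j, IsSim e (τ j) (f j)) {s t : ℝ} (ht : 0 < t) (hs : s < 1)
    (hτ : ∀ j, t ≤ τ j ∧ τ j ≤ s) (hC : IsAttractor f C) (hCi : interior C = ∅)
    (hO : IsOpen O) (hOn : O.Nonempty)
    (hOb : Bornology.IsBounded O) (hfO : ∀ j, MapsTo (f j) O O)
    (hd : ∀ i j, i ≠ j → Disjoint (f i '' O) (f j '' O)) :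
    ∃ δ : ℝ, 0 < δ ∧ ∀ (x : Fin d → ℝ) (r : ℝ), 0 < r → r ≤ 1 →
      ∃ y, ∀ z, ‖z - y‖ < δ * r → ‖z - x‖ < r ∧ z ∉ C := by
  have hτ0 : ∀ j, 0 < τ j ∧ τ j ≤ s := fun j => ⟨ht.trans_le (hτ j).1, (hτ j).2⟩
  have hvol := volume_attractor_eq_zero hf hs hτ0 hC hCi hO hOn hOb hfO hd
  have ht1 : t ≤ 1 := by
    obtain ⟨c, hc⟩ := hC.1
    rw [← hC.2.2] at hc
    obtain ⟨j, -⟩ := mem_iUnion.1 hc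
    exact ((hτ j).1.trans (hτ j).2).trans hs.le
  obtain ⟨N, hN⟩ := exists_card_pieces_le (e := e) ht hO hOn (hC.2.1.isBounded.union hOb)
  set B := distortion e
  have hB : 0 < B := distortion_pos
  set V := volume (Metric.ball (0 : Fin d → ℝ) 1)
  have hV0 : V ≠ 0 := (Metric.measure_ball_pos volume _ one_pos).ne'
  -- As `C` is null, some `η` makes `N` copies of the `η`-thickening smaller in volume than a ball
  -- of radius `1 / 2`.
  have hlim : Tendsto (fun η => (N : ENNReal) * volume (Metric.cthickening η C)) (𝓝 0) (𝓝 0) := by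
    have := ENNReal.Tendsto.const_mul (a := (N : ENNReal))
      (tendsto_measure_cthickening_of_isCompact (μ := volume) hC.2.1)
      (Or.inr (ENNReal.natCast_ne_top N))
    rwa [hvol, mul_zero] at this
  have hpos : 0 < ENNReal.ofReal ((1 / 2 : ℝ) ^ d) * V :=
    ENNReal.mul_pos (ENNReal.ofReal_pos.2 (by positivity)).ne' hV0
  obtain ⟨η₀, hη₀, hη⟩ := Metric.eventually_nhds_iff.1 (hlim.eventually (gt_mem_nhds hpos))
  have hη' := hη (y := η₀ / 2) (by
    rw [Real.dist_eq, sub_zero, abs_of_pos (by positivity)]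
    linarith)
  set η := η₀ / 2
  have hηp : 0 < η := by positivity
  -- The bound `1 / 2` keeps the hole inside the ball of radius `r`. With `η * t / B`, a point of
  -- `C` in the hole would place `y` in the image of the `η`-thickening of `C` under some `g i`,
  -- contrary to the choice of `y`.
  refine ⟨min (1 / 2) (η * t / B), by positivity, fun x r hr hr1 => ?_⟩
  set δ := min (1 / 2) (η * t / B)
  have hδB : B * δ ≤ η * t := by
    have : δ ≤ η * t / B := min_le_right _ _
    rwa [le_div_iff₀ hB, mul_comm] at this
  have hδ2 : δ ≤ 1 / 2 := min_le_left _ _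
  obtain ⟨ι, hι, g, ρ, h1, h2, h3, h4⟩ := exists_pieces hf ht hs hτ hr
  have htr : min 1 (t * r) = t * r := min_eq_right (mul_le_one₀ ht1 hr.le hr1)
  rw [htr] at h1
  have hρ : ∀ i, 0 < ρ i := fun i => (mul_pos ht hr).trans_le (h1 i).1
  let I : Type := {i : ι // ∃ u ∈ C, ‖g i u - x‖ < r}
  have : Fintype I := Fintype.ofFinite I
  have hcard : Fintype.card I ≤ N := hN I (fun i => g i) (fun i => ρ i) r x hr (fun i => h1 i)
    (fun i i' hne => h4 O hfO hd (Subtype.coe_injective.ne hne)) fun i => i.2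
  let bad : Set (Fin d → ℝ) := ⋃ i : I, g i '' Metric.cthickening η C
  have hbad : volume bad < volume (Metric.ball x (r * (1 / 2))) := by
    calc volume bad ≤ ∑ i : I, volume (g i '' Metric.cthickening η C) :=
          measure_iUnion_fintype_le _ _
      _ ≤ ∑ i : I, ENNReal.ofReal (r ^ d) * volume (Metric.cthickening η C) :=
          Finset.sum_le_sum fun i _ => by
            rw [(h1 i).2.2.volume_image (hρ i)]
            have := (hρ i).le
            gcongr
            exact (h1 i).2.1
      _ = ENNReal.ofReal (r ^ d) * (Fintype.card I * volume (Metric.cthickening η C)) := by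
          rw [Finset.sum_const, Finset.card_univ, nsmul_eq_mul, mul_left_comm]
      _ ≤ ENNReal.ofReal (r ^ d) * (N * volume (Metric.cthickening η C)) := by
          gcongr
      _ < ENNReal.ofReal (r ^ d) * (ENNReal.ofReal ((1 / 2 : ℝ) ^ d) * V) :=
          (ENNReal.mul_lt_mul_iff_right (ENNReal.ofReal_pos.2 (pow_pos hr d)).ne'
            ENNReal.ofReal_ne_top).2 hη'
      _ = volume (Metric.ball x (r * (1 / 2))) := by
          rw [Measure.addHaar_ball_of_pos _ _ (by positivity), Module.finrank_fin_fun, mul_pow,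
            ENNReal.ofReal_mul (by positivity), mul_assoc]
  obtain ⟨y, hy, hyb⟩ : ∃ y ∈ Metric.ball x (r * (1 / 2)), y ∉ bad := by
    by_contra! h
    exact absurd (measure_mono h) (not_le.2 hbad)
  rw [mem_ball_iff_norm] at hy
  refine ⟨y, fun z hz => ?_⟩
  have hzx : ‖z - x‖ < r := by
    calc ‖z - x‖ = ‖(z - y) + (y - x)‖ := by rw [sub_add_sub_cancel]
      _ ≤ ‖z - y‖ + ‖y - x‖ := norm_add_le _ _
      _ < r := by nlinarith
  refine ⟨hzx, fun hzC => hyb ?_⟩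
  obtain ⟨i, u, hu, rfl⟩ := mem_iUnion.1 (h3 C hC.2.2 hzC)
  obtain ⟨w, rfl⟩ := (h1 i).2.2.surjective (hρ i) y
  refine mem_iUnion.2 ⟨⟨i, u, hu, hzx⟩, w, Metric.mem_cthickening_of_dist_le w u η C hu ?_, rfl⟩
  have h5 := (h1 i).2.2.le_norm_sub (hρ i) w u
  rw [norm_sub_rev (g i w)] at h5
  rw [dist_eq_norm]
  refine le_of_mul_le_mul_left ?_ (hρ i)
  calc ρ i * ‖w - u‖ ≤ B * (δ * r) := h5.trans (by gcongr)
    _ = (B * δ) * r := by ring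
    _ ≤ (η * t) * r := by gcongr
    _ = (t * r) * η := by ring
    _ ≤ ρ i * η := by gcongr; exact (h1 i).1

end Porosity

/-! ### Extrinsic approximation: grid points in holes, and prime denominators -/

section Extrinsic

variable {d : ℕ} {C : Set (Fin d → ℝ)}

/-- Rational vectors off `C` of denominator at most `n` approximate every point of `C` to within
`K / n`, for all large `n`. -/
def EventuallyApprox (C : Set (Fin d → ℝ)) : Prop :=
  ∃ K : ℝ, 0 < K ∧ ∀ᶠ n : ℕ in atTop, ∀ ξ ∈ C, ∃ (p : Fin d → ℤ) (q : ℕ), 1 ≤ q ∧ q ≤ n ∧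
    ratVec p q ∉ C ∧ ‖ξ - ratVec p q‖ ≤ K / n

/-- At scale `2 / δ / n` the hole has radius `2 / n`, and rounding its centre down to `n⁻¹ ℤ^d`
moves each coordinate by at most `1 / n`. -/
theorem eventuallyApprox_of_holes {δ : ℝ} (hδ : 0 < δ)
    (h : ∀ (x : Fin d → ℝ) (r : ℝ), 0 < r → r ≤ 1 →
      ∃ y, ∀ z, ‖z - y‖ < δ * r → ‖z - x‖ < r ∧ z ∉ C) : EventuallyApprox C := by
  refine ⟨2 / δ, by positivity, ?_⟩
  filter_upwards [eventually_ge_atTop 1, eventually_ge_atTop ⌈2 / δ⌉₊] with n h1 hn ξ _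
  have hn0 : (0 : ℝ) < n := by exact_mod_cast h1
  obtain ⟨y, hy⟩ := h ξ (2 / δ / n) (by positivity)
    ((div_le_one hn0).2 (Nat.ceil_le.1 hn))
  have hz : ‖ratVec (fun i => ⌊n * y i⌋) n - y‖ < δ * (2 / δ / n) := by
    refine lt_of_le_of_lt (b := 1 / (n : ℝ)) ((pi_norm_le_iff_of_nonneg (by positivity)).2
      fun i => ?_) ?_
    · have h1 := Int.floor_le (n * y i)
      have h2 := Int.lt_floor_add_one (n * y i)
      have : ratVec (fun i => ⌊n * y i⌋) n i - y i = (⌊n * y i⌋ - n * y i) / n := by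
        simp only [ratVec]
        field_simp
      rw [Pi.sub_apply, this, Real.norm_eq_abs, abs_div, abs_of_pos hn0]
      gcongr
      rw [abs_le]
      constructor <;> linarith
    · have : δ * (2 / δ / n) = 2 / n := by field_simp
      rw [this]
      gcongr
      norm_num
  obtain ⟨h1', h2'⟩ := hy _ hz
  refine ⟨_, n, h1, le_rfl, h2', ?_⟩
  rw [norm_sub_rev]
  exact h1'.le

theorem EventuallyApprox.uniform [NeZero d] (h : EventuallyApprox C) (hC : IsCompact C) :
    ∃ K : ℝ, 0 < K ∧ ∀ ξ ∈ C, ∀ Q : ℝ, 1 < Q →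
      ∃ (p : Fin d → ℤ) (q : ℕ), 1 ≤ q ∧ (q : ℝ) ≤ Q ∧
        ratVec p q ∉ C ∧ ‖ξ - ratVec p q‖ ≤ K / Q := by
  obtain ⟨K, hK, hev⟩ := h
  obtain ⟨n₀, hn₀⟩ := eventually_atTop.1 hev
  obtain ⟨R, hR0, hR⟩ := hC.isBounded.exists_pos_norm_le
  let P : Fin d → ℤ := fun _ => ⌈R⌉ + 1
  have hPn : R < ‖ratVec P 1‖ := by
    have h1 := norm_le_pi_norm (ratVec P 1) 0
    have h2 : R ≤ ⌈R⌉ := Int.le_ceil R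
    have h3 : ‖ratVec P 1 0‖ = |(⌈R⌉ + 1 : ℝ)| := by simp [ratVec, P]
    rw [h3] at h1
    have := le_abs_self (⌈R⌉ + 1 : ℝ)
    linarith
  have hP : ratVec P 1 ∉ C := fun hmem => not_lt.2 (hR _ hmem) hPn
  set A := R + ‖ratVec P 1‖
  have hA : 0 < A := by positivity
  -- The term `2 * K` pays for replacing `Q` by `⌊Q⌋₊ ≥ Q / 2`; the other pays for using the integer
  -- vector `P` when `Q ≤ n₀ + 1`.
  refine ⟨2 * K + A * (n₀ + 1), by positivity, fun ξ hξ Q hQ => ?_⟩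
  have hQ0 : 0 < Q := one_pos.trans hQ
  have hfl : Q < ⌊Q⌋₊ + 1 := Nat.lt_floor_add_one Q
  rcases le_or_gt n₀ ⌊Q⌋₊ with hn | hn
  · obtain ⟨p, q, h1, h2, h3, h4⟩ := hn₀ _ hn ξ hξ
    have hf1 : (1 : ℝ) ≤ ⌊Q⌋₊ := by
      exact_mod_cast Nat.le_floor (by exact_mod_cast hQ.le)
    refine ⟨p, q, h1, (Nat.cast_le.2 h2).trans (Nat.floor_le hQ0.le), h3, h4.trans ?_⟩
    rw [div_le_div_iff₀ (by positivity) hQ0]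
    have : 0 ≤ A * (n₀ + 1) * ⌊Q⌋₊ := by positivity
    nlinarith
  · refine ⟨P, 1, le_rfl, by simpa using hQ.le, hP, ?_⟩
    have h1 : ‖ξ - ratVec P 1‖ ≤ A := (norm_sub_le _ _).trans
      (add_le_add_left (hR ξ hξ) _)
    have h2 : Q ≤ n₀ + 1 := by
      have : (⌊Q⌋₊ : ℝ) ≤ n₀ := by exact_mod_cast hn.le
      linarith
    refine h1.trans ((le_div_iff₀ hQ0).2 ?_)
    nlinarith

/-- Lower bound of Chebyshev type for the number of primes in `(√n, n]`. -/
theorem eventually_lt_card_primes {β : ℝ} (hβ : β < 1) (c : ℝ) :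
    ∀ᶠ n : ℕ in atTop,
      c * (n : ℝ) ^ β < ((Finset.range (n + 1)).filter fun q => q.Prime ∧ n < q * q).card := by
  -- With `γ ≥ 1 / 2`, the discarded numbers up to `√n` cost at most `n ^ γ + 1 < 2 * n ^ γ`, whence
  -- the constant `|c| + 2` below.
  set γ := max β (1 / 2) with hγ
  have hγ1 : γ < 1 := max_lt hβ (by norm_num)
  have hl2 : 0 < Real.log 2 := Real.log_pos (by norm_num)
  have e1 : ∀ᶠ x : ℝ in atTop, (|c| + 2) * (Real.log x * x ^ γ) ≤ Real.log 2 / 4 * x := by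
    have hpos : 0 < Real.log 2 / 4 / (|c| + 2) := by positivity
    filter_upwards [(isLittleO_log_rpow_atTop (sub_pos.2 hγ1)).def hpos,
      eventually_ge_atTop 1] with x hx h1
    have hx0 : 0 < x := by linarith
    rw [Real.norm_of_nonneg (Real.log_nonneg h1),
      Real.norm_of_nonneg (Real.rpow_nonneg hx0.le _)] at hx
    calc (|c| + 2) * (Real.log x * x ^ γ)
        ≤ (|c| + 2) * (Real.log 2 / 4 / (|c| + 2) * x ^ (1 - γ) * x ^ γ) := by gcongr
      _ = Real.log 2 / 4 * (x ^ (1 - γ) * x ^ γ) := by field_simp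
      _ = Real.log 2 / 4 * x := by rw [← Real.rpow_add hx0]; simp
  have e2 : ∀ᶠ x : ℝ in atTop, Real.log (x + 1) ≤ Real.log 2 / 4 * (x + 1) := by
    have h := Real.isLittleO_log_id_atTop.def (show 0 < Real.log 2 / 4 by positivity)
    have h' := (tendsto_atTop_add_const_right atTop (1 : ℝ) tendsto_id).eventually h
    filter_upwards [h', eventually_ge_atTop 1] with x hx h1
    simp only [id] at hx
    rwa [Real.norm_of_nonneg (Real.log_nonneg (by linarith)),
      Real.norm_of_nonneg (by linarith)] at hx
  filter_upwards [tendsto_natCast_atTop_atTop.eventually e1,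
    tendsto_natCast_atTop_atTop.eventually e2, eventually_ge_atTop 2] with n h1 h2 hn
  have hn' : (2 : ℝ) ≤ n := by exact_mod_cast hn
  have hlog : 0 < Real.log n := Real.log_pos (by linarith)
  have hpow : 0 < (n : ℝ) ^ γ := Real.rpow_pos_of_pos (by linarith) _
  have hpi : (|c| + 2) * (n : ℝ) ^ γ ≤ Nat.primeCounting n := by
    refine le_trans ?_ (Chebyshev.pi_ge n)
    rw [le_div_iff₀ hlog]
    nlinarith
  have hcount : Nat.primeCounting n ≤
      ((Finset.range (n + 1)).filter fun q => q.Prime ∧ n < q * q).card + (Nat.sqrt n + 1) := by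
    rw [Nat.primeCounting, Nat.primeCounting', Nat.count_eq_card_filter_range,
      ← Finset.card_range (Nat.sqrt n + 1)]
    refine (Finset.card_le_card fun q hq => ?_).trans (Finset.card_union_le _ _)
    simp only [Finset.mem_union, Finset.mem_filter, Finset.mem_range] at hq ⊢
    rcases lt_or_ge n (q * q) with h | h
    · exact Or.inl ⟨hq.1, hq.2, h⟩
    · exact Or.inr (Nat.lt_succ_of_le (Nat.le_sqrt.2 h))
  have hsq : (Nat.sqrt n : ℝ) ≤ (n : ℝ) ^ γ := by
    refine Real.nat_sqrt_le_real_sqrt.trans ?_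
    rw [Real.sqrt_eq_rpow]
    exact Real.rpow_le_rpow_of_exponent_le (by linarith) (le_max_right _ _)
  have h1γ : 1 < (n : ℝ) ^ γ :=
    Real.one_lt_rpow (by linarith) (lt_max_of_lt_right (by norm_num))
  have hcβ : c * (n : ℝ) ^ β ≤ |c| * (n : ℝ) ^ γ :=
    mul_le_mul (le_abs_self c)
      (Real.rpow_le_rpow_of_exponent_le (by linarith) (le_max_left _ _))
      (Real.rpow_nonneg (by linarith) _) (abs_nonneg c)
  have hcount' : (Nat.primeCounting n : ℝ) ≤
      ((Finset.range (n + 1)).filter fun q => q.Prime ∧ n < q * q).card + (Nat.sqrt n + 1) := by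
    exact_mod_cast hcount
  linarith

/-- Near any point there is a rational vector of denominator `q * m`, where `m = n / q`, whose
first coordinate has the prime `q` in its denominator. -/
theorem exists_ratVec_not_dvd [NeZero d] (ξ : Fin d → ℝ) {n q : ℕ} (hq : q.Prime) (hqn : q ≤ n) :
    ∃ p : Fin d → ℤ, ¬ (q : ℤ) ∣ p 0 ∧ ‖ξ - ratVec p (q * (n / q))‖ ≤ 2 / n := by
  set N := q * (n / q) with hN
  have hq0 := hq.pos
  have hm : 1 ≤ n / q := (Nat.one_le_div_iff hq0).2 hqn
  have hn0 : 0 < n := hq0.trans_le hqn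
  have hN1 : 1 ≤ N := Nat.mul_pos hq0 hm
  have hnN : n ≤ 2 * N := by
    have := Nat.lt_mul_div_succ n hq0
    nlinarith
  have hNr : (0 : ℝ) < N := by exact_mod_cast hN1
  have hbound : ∀ (x : ℝ) (k : ℤ), |N * x - k| ≤ 1 → ‖x - k / N‖ ≤ 2 / n := fun x k hk => by
    have : x - k / N = (N * x - k) / N := by field_simp
    rw [this, Real.norm_eq_abs, abs_div, abs_of_pos hNr,
      div_le_div_iff₀ hNr (by exact_mod_cast hn0)]
    have : (n : ℝ) ≤ 2 * N := by exact_mod_cast hnN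
    nlinarith
  have hfl : ∀ x : ℝ, |N * x - (⌊N * x⌋ : ℤ)| ≤ 1 ∧ |N * x - ((⌊N * x⌋ + 1 : ℤ) : ℝ)| ≤ 1 :=
    fun x => by
      have h1 := Int.floor_le (N * x)
      have h2 := Int.lt_floor_add_one (N * x)
      push_cast
      constructor <;> rw [abs_le] <;> constructor <;> linarith
  -- Two consecutive integers are not both divisible by `q`, and either rounding is accurate enough.
  by_cases hdvd : (q : ℤ) ∣ ⌊N * ξ 0⌋
  · refine ⟨fun i => ⌊N * ξ i⌋ + 1, fun h => ?_,
      (pi_norm_le_iff_of_nonneg (by positivity)).2 fun i => hbound _ _ (hfl (ξ i)).2⟩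
    have h1 : (q : ℤ) ∣ 1 := (Int.dvd_iff_dvd_of_dvd_add h).1 hdvd
    exact hq.one_lt.ne' (by exact_mod_cast Int.eq_one_of_dvd_one (by positivity) h1)
  · exact ⟨fun i => ⌊N * ξ i⌋, hdvd,
      (pi_norm_le_iff_of_nonneg (by positivity)).2 fun i => hbound _ _ (hfl (ξ i)).1⟩

theorem le_norm_ratVec_sub {p p' : Fin d → ℤ} {q q' : ℕ} (hq : 1 ≤ q) (hq' : 1 ≤ q') {i : Fin d}
    (h : p i * q' ≠ p' i * q) :
    1 / ((q : ℝ) * q') ≤ ‖ratVec p q - ratVec p' q'‖ := by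
  have hq0 : (0 : ℝ) < q := by exact_mod_cast hq
  have hq0' : (0 : ℝ) < q' := by exact_mod_cast hq'
  refine le_trans ?_ (norm_le_pi_norm _ i)
  have : (ratVec p q - ratVec p' q') i = ((p i * q' - p' i * q : ℤ) : ℝ) / (q * q') := by
    simp only [ratVec, Pi.sub_apply]
    push_cast
    field_simp
  rw [this, Real.norm_eq_abs, abs_div, abs_of_pos (mul_pos hq0 hq0')]
  gcongr
  rw [← Int.cast_abs]
  exact_mod_cast Int.one_le_abs (sub_ne_zero.2 h)

/-- The rational vectors attached to different primes in `(√n, n]` are separated. -/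
theorem le_norm_ratVec_sub_of_primes [NeZero d] {p p' : Fin d → ℤ} {n q q' : ℕ} (hq : q.Prime)
    (hq' : q'.Prime) (hne : q ≠ q') (hqn : q ≤ n) (hqn' : q' ≤ n) (hs : n < q * q)
    (hs' : n < q' * q') (hp : ¬ (q : ℤ) ∣ p 0) :
    1 / (n : ℝ) ^ 2 ≤ ‖ratVec p (q * (n / q)) - ratVec p' (q' * (n / q'))‖ := by
  have hpos : ∀ {q : ℕ}, q.Prime → q ≤ n → 1 ≤ q * (n / q) := fun hq hqn =>
    Nat.mul_pos hq.pos (Nat.div_pos hqn hq.pos)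
  have hle : ∀ q : ℕ, ((q * (n / q) : ℕ) : ℝ) ≤ n := fun q => by
    exact_mod_cast Nat.mul_div_le n q
  refine le_trans ?_ (le_norm_ratVec_sub (hpos hq hqn) (hpos hq' hqn') (i := 0) fun h => ?_)
  · have h1 : (1 : ℝ) ≤ (q * (n / q) : ℕ) := by exact_mod_cast hpos hq hqn
    have h2 : (1 : ℝ) ≤ (q' * (n / q') : ℕ) := by exact_mod_cast hpos hq' hqn'
    rw [sq]
    exact one_div_le_one_div_of_le (by positivity)
      (mul_le_mul (hle q) (hle q') (by positivity) (by positivity))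
  · have hqp : Prime (q : ℤ) := Nat.prime_iff_prime_int.1 hq
    have h1 : (q : ℤ) ∣ p 0 * (q' * (n / q') : ℕ) := by
      rw [h, Nat.cast_mul]
      exact Dvd.intro _ (by ring : (q : ℤ) * (p' 0 * ((n / q : ℕ) : ℤ)) = _)
    -- As `q ≠ q'`, this forces `q ≤ n / q'`, so `q * q' ≤ n`, contradicting that both primes exceed
    -- `√n`.
    have h2 : q ∣ q' * (n / q') := by exact_mod_cast (hqp.dvd_or_dvd h1).resolve_left hp
    rcases hq.dvd_mul.1 h2 with h3 | h3
    · exact hne ((Nat.prime_dvd_prime_iff_eq hq hq').1 h3)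
    · have h4 : q ≤ n / q' := Nat.le_of_dvd (Nat.div_pos hqn' hq'.pos) h3
      have h5 : q * q' ≤ n := (Nat.le_div_iff_mul_le hq'.pos).1 h4
      rcases le_total q q' with h6 | h6
      · nlinarith
      · nlinarith

/-- Take `k` just above `log X / (-log s)` with `X = (A + 1) * n ^ 2`. Since `J = s ^ (-D)`, `J ^ k`
is at most `X ^ D` times a rounding factor `J`. -/
theorem exists_pow_lt_and_card_le {J : ℕ} (hJ : 1 ≤ J) {s : ℝ} (hs0 : 0 < s) (hs : s < 1)
    (A : ℝ) (hA : 0 < A) : ∃ c : ℝ, ∀ n : ℕ, 1 ≤ n → ∃ k : ℕ, A * s ^ k < 1 / (n : ℝ) ^ 2 ∧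
      (J : ℝ) ^ k ≤ c * (n : ℝ) ^ (2 * (-Real.log J / Real.log s)) := by
  set D := -Real.log J / Real.log s with hD
  have hls : Real.log s < 0 := Real.log_neg hs0 hs
  have hJr : (1 : ℝ) ≤ J := by exact_mod_cast hJ
  have hJ0 : (0 : ℝ) < J := by linarith
  have hlJ : 0 ≤ Real.log J := Real.log_nonneg hJr
  refine ⟨J * (A + 1) ^ D, fun n hn => ?_⟩
  have hn1 : (1 : ℝ) ≤ n := by exact_mod_cast hn
  have hn0 : (0 : ℝ) < n := by linarith
  set X := (A + 1) * (n : ℝ) ^ 2 with hX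
  have hX1 : 1 ≤ X := by rw [hX]; nlinarith [one_le_pow₀ hn1 (n := 2)]
  have hX0 : 0 < X := by linarith
  set x := Real.log X / -Real.log s with hx
  have hx0 : 0 ≤ x := div_nonneg (Real.log_nonneg hX1) (by linarith)
  refine ⟨⌊x⌋₊ + 1, ?_, ?_⟩
  · have h1 : x < (⌊x⌋₊ + 1 : ℕ) := by exact_mod_cast Nat.lt_floor_add_one x
    nth_rewrite 1 [hx] at h1
    rw [div_lt_iff₀ (by linarith)] at h1
    have h2 : s ^ (⌊x⌋₊ + 1) < X⁻¹ := by
      rw [← Real.log_lt_log_iff (by positivity) (by positivity), Real.log_pow, Real.log_inv]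
      linarith
    have h3 : A * s ^ (⌊x⌋₊ + 1) < (A + 1) * X⁻¹ := by
      have : 0 < s ^ (⌊x⌋₊ + 1) := by positivity
      have : 0 < X⁻¹ := by positivity
      nlinarith
    refine h3.trans_le (le_of_eq ?_)
    rw [hX]
    field_simp
  · have h1 : (J : ℝ) ^ (⌊x⌋₊ + 1) ≤ J * (J : ℝ) ^ x := by
      rw [pow_succ', ← Real.rpow_natCast]
      exact mul_le_mul_of_nonneg_left
        (Real.rpow_le_rpow_of_exponent_le hJr (Nat.floor_le hx0)) hJ0.le
    refine h1.trans (le_of_eq ?_)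
    have h2 : (J : ℝ) ^ x = X ^ D := by
      rw [Real.rpow_def_of_pos hJ0, Real.rpow_def_of_pos hX0]
      congr 1
      rw [hx, hD]
      field_simp
    rw [h2, hX, Real.mul_rpow (by positivity) (by positivity), mul_assoc, Real.rpow_mul hn0.le,
      Real.rpow_two]

variable {E : Type*} [NormedAddCommGroup E] [NormedSpace ℝ E]
  {e : E ≃L[ℝ] (Fin d → ℝ)} {J : ℕ} {f : Fin J → (Fin d → ℝ) → (Fin d → ℝ)} {τ : Fin J → ℝ}

/-- Pigeonhole: primes in `(√n, n]` outnumber the words of length `k`, so two separated rational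
vectors would share a piece too small to hold both. -/
theorem eventuallyApprox_of_bound_lt [NeZero d] (hf : ∀ j, IsSim e (τ j) (f j)) {s : ℝ}
    (hs0 : 0 < s) (hs : s < 1) (hτ : ∀ j, 0 ≤ τ j ∧ τ j ≤ s) (hC : IsAttractor f C)
    (hD : -Real.log (J : ℝ) / Real.log s < 1 / 2) : EventuallyApprox C := by
  have hJ : 1 ≤ J := by
    obtain ⟨c, hc⟩ := hC.1
    rw [← hC.2.2] at hc
    obtain ⟨j, -⟩ := mem_iUnion.1 hc
    exact Fin.pos j
  obtain ⟨R, hR⟩ := Metric.isBounded_iff.1 hC.2.1.isBounded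
  have hR0 : 0 ≤ R := by
    obtain ⟨c, hc⟩ := hC.1
    exact dist_nonneg.trans (hR hc hc)
  have hB : 0 < distortion e := distortion_pos
  obtain ⟨c, hc⟩ := exists_pow_lt_and_card_le hJ hs0 hs (distortion e * (R + 1)) (by positivity)
  refine ⟨2, two_pos, ?_⟩
  filter_upwards [eventually_lt_card_primes (β := 2 * (-Real.log (J : ℝ) / Real.log s))
    (by linarith) c, eventually_ge_atTop 1] with n hcard hn ξ _
  by_contra! hall
  obtain ⟨k, hk, hJk⟩ := hc n hn
  obtain ⟨g, hg, hcov⟩ := exists_cover hf hτ k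
  set S := (Finset.range (n + 1)).filter fun q => q.Prime ∧ n < q * q with hS
  have hmem : ∀ q ∈ S, q.Prime ∧ q ≤ n ∧ n < q * q := fun q hq => by
    simp only [hS, Finset.mem_filter, Finset.mem_range] at hq
    exact ⟨hq.2.1, Nat.lt_succ_iff.1 hq.1, hq.2.2⟩
  choose! p hp hpξ using fun (q : ℕ) (hq : q ∈ S) =>
    exists_ratVec_not_dvd ξ (hmem q hq).1 (hmem q hq).2.1
  have hpC : ∀ q ∈ S, ∃ i, ratVec (p q) (q * (n / q)) ∈ g i '' C := fun q hq => by
    refine mem_iUnion.1 (hcov C hC.2.2 ?_)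
    by_contra hnot
    obtain ⟨h1, h2, -⟩ := hmem q hq
    exact absurd (hpξ q hq) (not_le.2 (hall (p q) _
      (Nat.mul_pos h1.pos (Nat.div_pos h2 h1.pos)) (Nat.mul_div_le n q) hnot))
  have : Nonempty (Fin k → Fin J) := ⟨fun _ => ⟨0, hJ⟩⟩
  choose! i hi using hpC
  have hlt : (Finset.univ : Finset (Fin k → Fin J)).card < S.card := by
    have : ((J ^ k : ℕ) : ℝ) < S.card := by
      push_cast
      exact hJk.trans_lt hcard
    simpa using (by exact_mod_cast this : J ^ k < S.card)
  obtain ⟨q, hq, q', hq', hne, heq⟩ :=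
    Finset.exists_ne_map_eq_of_card_lt_of_maps_to hlt (f := i) fun _ _ => Finset.mem_univ _
  obtain ⟨h1, h2, h3⟩ := hmem q hq
  obtain ⟨h1', h2', h3'⟩ := hmem q' hq'
  have hsep := le_norm_ratVec_sub_of_primes (p' := p q') h1 h1' hne h2 h2' h3 h3' (hp q hq)
  obtain ⟨u, hu, hu'⟩ := hi q hq
  obtain ⟨v, hv, hv'⟩ := hi q' hq'
  obtain ⟨ρ, hρ0, hρ, hsim⟩ := hg (i q)
  rw [← hu', ← hv', ← heq] at hsep
  have h4 := hsim.norm_sub_le hρ0 u v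
  have h5 : ‖u - v‖ ≤ R := by rw [← dist_eq_norm]; exact hR hu hv
  have h6 : distortion e * ρ * ‖u - v‖ ≤ distortion e * s ^ k * (R + 1) := by
    gcongr
    linarith
  linarith

end Extrinsic

/-! ### Rational points of the attractor and Baire category -/

section Intrinsic

variable {d : ℕ} {C : Set (Fin d → ℝ)}

theorem exists_isReduced {x : Fin d → ℝ} (hx : x ∈ ratPoints d) :
    ∃ (p : Fin d → ℤ) (q : ℕ), IsReduced p q ∧ ratVec p q = x := by
  classical
  have hex : ∃ q : ℕ, 1 ≤ q ∧ ∃ p : Fin d → ℤ, ratVec p q = x := by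
    obtain ⟨y, rfl⟩ := hx
    refine ⟨∏ i, (y i).den, Finset.prod_pos fun i _ => (y i).den_pos,
      fun i => (y i).num * ∏ j ∈ Finset.univ.erase i, ((y j).den : ℤ), funext fun i => ?_⟩
    have h1 : (∏ j ∈ Finset.univ.erase i, ((y j).den : ℝ)) ≠ 0 :=
      Finset.prod_ne_zero_iff.2 fun j _ => by exact_mod_cast (y j).den_nz
    have h2 : ((y i).den : ℝ) ≠ 0 := by exact_mod_cast (y i).den_nz
    simp only [ratVec]
    push_cast
    rw [← Finset.mul_prod_erase _ _ (Finset.mem_univ i), mul_div_mul_right _ _ h1, Rat.cast_def]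
  -- The least denominator is reduced: a common factor could be cancelled.
  obtain ⟨h1, p, hp⟩ := Nat.find_spec hex
  refine ⟨p, Nat.find hex, ⟨h1, fun n ⟨m, hm⟩ hn => ?_⟩, hp⟩
  choose p' hp' using hn
  have hn0 : 0 < n := Nat.pos_of_ne_zero fun h => by
    rw [hm, h, zero_mul] at h1
    omega
  have hm0 : 0 < m := Nat.pos_of_ne_zero fun h => by
    rw [hm, h, mul_zero] at h1
    omega
  have hle : Nat.find hex ≤ m := Nat.find_min' hex ⟨hm0, p', by
    rw [← hp, hm]
    funext i
    have : (n : ℝ) ≠ 0 := by exact_mod_cast hn0.ne'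
    simp only [ratVec, hp']
    push_cast
    rw [mul_div_mul_left _ _ this]⟩
  rw [hm] at hle
  by_contra hne
  have : 2 ≤ n := by omega
  nlinarith

theorem ratVec_mem_ratPoints (p : Fin d → ℤ) (q : ℕ) : ratVec p q ∈ ratPoints d :=
  ⟨fun i => (p i : ℚ) / q, by funext i; simp [ratVec]⟩

/-- If the rational points of the compact set `C` are dense in `C` and `C` has no isolated point,
then `C` contains irrational points extremely close to rational points of `C`. -/
theorem exists_irrational_close (hC : IsCompact C) (hne : C.Nonempty)
    (hdense : ∀ ξ ∈ C, ∀ ε > 0, ∃ x ∈ C, x ∈ ratPoints d ∧ ‖ξ - x‖ < ε)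
    (hperf : ∀ ξ ∈ C, ∀ ε > 0, ∃ x ∈ C, x ≠ ξ ∧ ‖ξ - x‖ < ε)
    (ρ : ℕ → ℕ → ℝ) (hρ : ∀ m q, 1 ≤ q → 0 < ρ m q) :
    ∃ ξ ∈ C, ξ ∉ ratPoints d ∧ ∀ m, ∃ (p : Fin d → ℤ) (q : ℕ), IsReduced p q ∧ ratVec p q ∈ C ∧
      ‖ξ - ratVec p q‖ < ρ m q := by
  have : CompactSpace C := isCompact_iff_compactSpace.1 hC
  have : Nonempty C := hne.to_subtype
  -- One dense open set for each `m`, and one omitting each rational point; the latter is dense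
  -- because `C` has no isolated point.
  let U : ℕ ⊕ (Fin d → ℚ) → Set C := Sum.elim
    (fun m => {ξ | ∃ (p : Fin d → ℤ) (q : ℕ), IsReduced p q ∧ ratVec p q ∈ C ∧
      ‖(ξ : Fin d → ℝ) - ratVec p q‖ < ρ m q})
    (fun x => {ξ | (ξ : Fin d → ℝ) ≠ fun i => (x i : ℝ)})
  have hUo : ∀ a, IsOpen (U a) := by
    rintro (m | x)
    · have : U (Sum.inl m) = ⋃ (p : Fin d → ℤ) (q : ℕ) (_ : IsReduced p q ∧ ratVec p q ∈ C),
          {ξ : C | ‖(ξ : Fin d → ℝ) - ratVec p q‖ < ρ m q} := by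
        ext ξ
        simp only [mem_iUnion]
        exact ⟨fun ⟨p, q, h1, h2, h3⟩ => ⟨p, q, ⟨h1, h2⟩, h3⟩,
          fun ⟨p, q, ⟨h1, h2⟩, h3⟩ => ⟨p, q, h1, h2, h3⟩⟩
      rw [this]
      exact isOpen_iUnion fun p => isOpen_iUnion fun q => isOpen_iUnion fun _ =>
        isOpen_lt (by fun_prop) continuous_const
    · exact isOpen_ne.preimage continuous_subtype_val
  have hUd : ∀ a, Dense (U a) := by
    rintro (m | x) <;> refine Metric.dense_iff.2 fun ξ ε hε => ?_
    · obtain ⟨x, hxC, hx, hlt⟩ := hdense ξ ξ.2 ε hε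
      obtain ⟨p, q, hpq, rfl⟩ := exists_isReduced hx
      refine ⟨⟨_, hxC⟩, ?_, p, q, hpq, hxC, ?_⟩
      · rw [Metric.mem_ball', Subtype.dist_eq, dist_eq_norm]
        exact hlt
      · simpa using hρ m q hpq.1
    · by_cases h : (ξ : Fin d → ℝ) = fun i => (x i : ℝ)
      · obtain ⟨y, hyC, hy, hlt⟩ := hperf ξ ξ.2 ε hε
        refine ⟨⟨y, hyC⟩, ?_, fun h' => hy (h'.trans h.symm)⟩
        rw [Metric.mem_ball', Subtype.dist_eq, dist_eq_norm]
        exact hlt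
      · exact ⟨ξ, Metric.mem_ball_self hε, h⟩
  obtain ⟨ξ, hξ⟩ := (dense_iInter_of_isOpen hUo hUd).nonempty
  rw [mem_iInter] at hξ
  exact ⟨ξ, ξ.2, fun ⟨x, hx⟩ => hξ (Sum.inr x) hx.symm, fun m => hξ (Sum.inl m)⟩

/-- A finite set of rational vectors is closed, so it cannot accumulate at an irrational point. -/
theorem infinite_of_forall_exists_close {ξ : Fin d → ℝ} (hξ : ξ ∉ ratPoints d)
    {S : Set ((Fin d → ℤ) × ℕ)} (h : ∀ ε > 0, ∃ r ∈ S, ‖ξ - ratVec r.1 r.2‖ < ε) :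
    S.Infinite := by
  intro hfin
  have hcl : ξ ∈ closure ((fun r : (Fin d → ℤ) × ℕ => ratVec r.1 r.2) '' S) :=
    Metric.mem_closure_iff.2 fun ε hε => by
      obtain ⟨r, hr, hlt⟩ := h ε hε
      exact ⟨_, mem_image_of_mem _ hr, by rwa [dist_eq_norm]⟩
  rw [(hfin.image _).isClosed.closure_eq] at hcl
  obtain ⟨r, -, rfl⟩ := hcl
  exact hξ (ratVec_mem_ratPoints _ _)

/-- The rational points are dense in `C` and `C` has no isolated point. -/
structure IsRationallyPerfect (C : Set (Fin d → ℝ)) : Prop where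
  isCompact : IsCompact C
  nonempty : C.Nonempty
  dense : ∀ ξ ∈ C, ∀ ε > 0, ∃ x ∈ C, x ∈ ratPoints d ∧ ‖ξ - x‖ < ε
  perfect : ∀ ξ ∈ C, ∀ ε > 0, ∃ x ∈ C, x ≠ ξ ∧ ‖ξ - x‖ < ε

namespace IsRationallyPerfect

theorem exists_badly_extrinsic (hC : IsRationallyPerfect C) {Φ : ℕ → ℝ}
    (hΦ : Tendsto Φ atTop (𝓝 0)) :
    ∃ ξ ∈ C, ξ ∉ ratPoints d ∧
      ∃ᶠ Q : ℕ in atTop, ∀ (p : Fin d → ℤ) (q : ℕ), 1 ≤ q → q ≤ Q → ratVec p q ∉ C →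
        ‖ξ - ratVec p q‖ > Φ Q / (Q : ℝ) := by
  -- `Q` is fixed from `m` and `q₀` alone, so that the radius around `p₀ / q₀` may depend on it.
  -- Half the separation `1 / ((q₀ + 1) * Q)` is left for `ξ`.
  have hex : ∀ m q : ℕ, ∃ Q : ℕ, m + 1 ≤ Q ∧ Φ Q < 1 / (2 * (q + 1)) := fun m q =>
    ((eventually_ge_atTop (m + 1)).and
      (hΦ.eventually (gt_mem_nhds (by positivity)))).exists
  choose Q hQm hQΦ using hex
  have hQ0 : ∀ m q, (0 : ℝ) < Q m q := fun m q => by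
    exact_mod_cast (Nat.succ_pos m).trans_le (hQm m q)
  obtain ⟨ξ, hξC, hξ, hclose⟩ := exists_irrational_close hC.isCompact hC.nonempty hC.dense
    hC.perfect (fun m q => 1 / (2 * (q + 1)) / Q m q)
    fun m q _ => div_pos (by positivity) (hQ0 m q)
  refine ⟨ξ, hξC, hξ, frequently_atTop.2 fun m => ?_⟩
  obtain ⟨p₀, q₀, hred, hmem, hlt⟩ := hclose m
  refine ⟨Q m q₀, (Nat.le_succ m).trans (hQm m q₀), fun p q hq hqQ hpq => ?_⟩
  obtain ⟨i, hi⟩ : ∃ i, p i * q₀ ≠ p₀ i * q := by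
    by_contra! h
    refine hpq ?_
    have : ratVec p q = ratVec p₀ q₀ := funext fun i => by
      have h1 : (q : ℝ) ≠ 0 := by exact_mod_cast (Nat.one_le_iff_ne_zero.1 hq)
      have h2 : (q₀ : ℝ) ≠ 0 := by exact_mod_cast (Nat.one_le_iff_ne_zero.1 hred.1)
      simp only [ratVec]
      rw [div_eq_div_iff h1 h2]
      exact_mod_cast h i
    rwa [this]
  have hsep := le_norm_ratVec_sub hq hred.1 hi
  have hq0 : (0 : ℝ) < q := by exact_mod_cast hq
  have hq₀ : (0 : ℝ) < q₀ := by exact_mod_cast hred.1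
  have hqQ' : (q : ℝ) ≤ Q m q₀ := by exact_mod_cast hqQ
  have h1 : 1 / ((q₀ + 1 : ℝ) * Q m q₀) ≤ 1 / ((q : ℝ) * q₀) := by
    refine one_div_le_one_div_of_le (by positivity) ?_
    rw [mul_comm]
    exact mul_le_mul (by linarith) hqQ' hq0.le (by positivity)
  have h2 : 1 / ((q₀ + 1 : ℝ) * Q m q₀) = 2 * (1 / (2 * (q₀ + 1)) / Q m q₀) := by
    have := (hQ0 m q₀).ne'
    field_simp
  have h3 : ‖ratVec p q - ratVec p₀ q₀‖ ≤ ‖ξ - ratVec p q‖ + ‖ξ - ratVec p₀ q₀‖ := by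
    rw [norm_sub_rev ξ (ratVec p q)]
    exact norm_sub_le_norm_sub_add_norm_sub _ _ _
  have h4 : Φ (Q m q₀) / Q m q₀ < 1 / (2 * (q₀ + 1)) / Q m q₀ := by
    have := hQ0 m q₀
    have := hQΦ m q₀
    gcongr
  linarith

theorem exists_intrinsicallyApproximable (hC : IsRationallyPerfect C) {Ψ : ℕ → ℝ}
    (hΨ : ∀ n, 0 < Ψ n) : ∃ ξ, IntrinsicallyApproximable C Ψ ξ := by
  obtain ⟨ξ, hξC, hξ, hclose⟩ := exists_irrational_close hC.isCompact hC.nonempty hC.dense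
    hC.perfect (fun m q => min (Ψ q) (1 / (m + 1))) fun m q _ => lt_min (hΨ q) (by positivity)
  refine ⟨ξ, hξC, infinite_of_forall_exists_close hξ fun ε hε => ?_⟩
  obtain ⟨m, hm⟩ := exists_nat_one_div_lt hε
  obtain ⟨p, q, hred, hmem, hlt⟩ := hclose m
  exact ⟨(p, q), ⟨hred, hmem, hlt.trans_le (min_le_left _ _)⟩,
    (hlt.trans_le (min_le_right _ _)).trans hm⟩

theorem exists_isLiouvilleVector (hC : IsRationallyPerfect C) :
    ∃ ξ ∈ C, IsLiouvilleVector ξ := by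
  obtain ⟨ξ, hξC, hξ, hclose⟩ := exists_irrational_close hC.isCompact hC.nonempty hC.dense
    hC.perfect (fun m q => min ((q : ℝ) ^ m)⁻¹ (1 / (m + 1))) fun m q hq => by
      have : (0 : ℝ) < q := by exact_mod_cast hq
      positivity
  refine ⟨ξ, hξC, hξ, fun N => infinite_of_forall_exists_close hξ fun ε hε => ?_⟩
  obtain ⟨m, hm⟩ := exists_nat_one_div_lt hε
  -- The index `m + N` secures both the exponent `N` and an error below `1 / (m + 1)`.
  obtain ⟨p, q, hred, hmem, hlt⟩ := hclose (m + N)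
  have hq : (1 : ℝ) ≤ q := by exact_mod_cast hred.1
  refine ⟨(p, q), ⟨hred, (hlt.trans_le (min_le_left _ _)).trans_le ?_⟩,
    ((hlt.trans_le (min_le_right _ _)).trans_le ?_).trans hm⟩
  · exact inv_anti₀ (by positivity) (pow_le_pow_right₀ hq (Nat.le_add_left N m))
  · refine one_div_le_one_div_of_le (by positivity) ?_
    push_cast
    linarith [(Nat.cast_nonneg N : (0 : ℝ) ≤ N)]

end IsRationallyPerfect

variable {E : Type*} [NormedAddCommGroup E] [NormedSpace ℝ E]
  {e : E ≃L[ℝ] (Fin d → ℝ)} {ρ : ℝ} {g : (Fin d → ℝ) → (Fin d → ℝ)}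

/-- A contracting similarity of `ℝ^d` that preserves `ℚ^d` has a rational fixed point. -/
theorem IsSim.exists_rational_fixed (h : IsSim e ρ g) (hρ : 0 < ρ) (hρ1 : ρ < 1)
    (hg : MapsTo g (ratPoints d) (ratPoints d)) : ∃ x ∈ ratPoints d, g x = x := by
  obtain ⟨L, hL⟩ := h.exists_linear hρ
  let ι : (Fin d → ℚ) → (Fin d → ℝ) := fun x i => (x i : ℝ)
  have hι : Function.Injective ι := fun x y hxy => funext fun i => by
    exact Rat.cast_injective (α := ℝ) (congrFun hxy i)
  have hιadd : ∀ x y, ι (x + y) = ι x + ι y := fun x y => funext fun i => by simp [ι]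
  have hιsub : ∀ x y, ι (x - y) = ι x - ι y := fun x y => funext fun i => by simp [ι]
  have hι0 : ι 0 = 0 := funext fun i => by simp [ι]
  choose F hF using fun x : Fin d → ℚ => hg (mem_range_self (f := ι) x)
  have hFι : ∀ x, ι (F x) = g (ι x) := hF
  have hLF : ∀ x, ι (F x - F 0) = L (ι x) := fun x => by
    rw [hιsub, hFι, hFι, hι0, hL (ι x)]
    exact add_sub_cancel_right _ _
  let M : (Fin d → ℚ) →+ (Fin d → ℚ) := AddMonoidHom.mk' (fun x => F x - F 0) fun x y => hι (by
    rw [hLF, hιadd, hιadd, map_add, hLF, hLF])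
  -- The linear part scales the transported norm by `ρ < 1`, so `1 - M` is injective, hence onto
  -- over `ℚ`; a preimage of `F 0` is a fixed point.
  let T : (Fin d → ℚ) →ₗ[ℚ] (Fin d → ℚ) := LinearMap.id - M.toRatLinearMap
  have hT : ∀ x, T x = x - (F x - F 0) := fun x => rfl
  have hTi : Function.Injective T := by
    rw [← LinearMap.ker_eq_bot, LinearMap.ker_eq_bot']
    intro x hx
    rw [hT, sub_eq_zero] at hx
    have hfix : L (ι x) = ι x := by rw [← hLF, ← hx]
    have hn := h (ι x) 0
    rw [hL (ι x), add_sub_cancel_right, hfix, sub_zero] at hn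
    have h0 : ‖e.symm (ι x)‖ = 0 := by nlinarith [norm_nonneg (e.symm (ι x))]
    rw [norm_eq_zero, map_eq_zero_iff _ e.symm.injective] at h0
    exact hι (h0.trans hι0.symm)
  obtain ⟨x, hx⟩ := LinearMap.surjective_of_injective hTi (F 0)
  have hFx : F x = x := by
    rw [hT, sub_sub_eq_add_sub, sub_eq_iff_eq_add] at hx
    exact (add_right_cancel (hx.trans (add_comm _ _))).symm
  exact ⟨ι x, mem_range_self x, by rw [← hFι, hFx]⟩

variable {J : ℕ} {f : Fin J → (Fin d → ℝ) → (Fin d → ℝ)} {τ : Fin J → ℝ}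

/-- Iterates of any point of `C` stay in `C` and converge to the fixed point. -/
theorem IsSim.fixed_mem (h : IsSim e ρ g) (hρ : 0 ≤ ρ) (hρ1 : ρ < 1) (hC : IsClosed C)
    (hne : C.Nonempty) (hgC : MapsTo g C C) {x : Fin d → ℝ} (hx : g x = x) : x ∈ C := by
  obtain ⟨c, hc⟩ := hne
  have hit : ∀ n, IsSim e (ρ ^ n) g^[n] := fun n => by
    induction n with
    | zero => exact isSim_id
    | succ n ih => rw [pow_succ, Function.iterate_succ]; exact ih.comp h
  have hlim : Tendsto (fun n => g^[n] c) atTop (𝓝 x) := by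
    rw [tendsto_iff_norm_sub_tendsto_zero]
    refine squeeze_zero (fun _ => norm_nonneg _) (fun n => ?_)
      (g := fun n => distortion e * ρ ^ n * ‖c - x‖) ?_
    · have := (hit n).norm_sub_le (pow_nonneg hρ n) c x
      rwa [Function.iterate_fixed hx] at this
    · simpa using ((tendsto_pow_atTop_nhds_zero_of_lt_one hρ hρ1).const_mul
        (distortion e)).mul_const ‖c - x‖
  exact hC.mem_of_tendsto hlim (Eventually.of_forall fun n => hgC.iterate n hc)

theorem isRationallyPerfect_attractor (hf : ∀ j, IsSim e (τ j) (f j)) {s t : ℝ} (ht : 0 < t)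
    (hs : s < 1) (hτ : ∀ j, t ≤ τ j ∧ τ j ≤ s) (hrat : IsRationalPreserving f)
    (hC : IsAttractor f C) (hnt : C.Nontrivial) : IsRationallyPerfect C := by
  have hfC : ∀ j, MapsTo (f j) C C := fun j x hx => by
    rw [← hC.2.2]
    exact mem_iUnion.2 ⟨j, mem_image_of_mem _ hx⟩
  have hτ0 : ∀ j, 0 < τ j := fun j => ht.trans_le (hτ j).1
  obtain ⟨x₀, hx₀C, hx₀⟩ : ∃ x ∈ C, x ∈ ratPoints d := by
    obtain ⟨c, hc⟩ := hC.1
    rw [← hC.2.2] at hc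
    obtain ⟨j, -⟩ := mem_iUnion.1 hc
    have h1 := (hτ j).2.trans_lt hs
    obtain ⟨x, hx, hfx⟩ := (hf j).exists_rational_fixed (hτ0 j) h1 (hrat j)
    exact ⟨x, (hf j).fixed_mem (hτ0 j).le h1 hC.2.1.isClosed hC.1 (hfC j) hfx, hx⟩
  obtain ⟨R, hR⟩ := Metric.isBounded_iff.1 hC.2.1.isBounded
  have hR0 : 0 ≤ R := dist_nonneg.trans (hR hx₀C hx₀C)
  have hB : 0 < distortion e := distortion_pos
  -- A small piece through `ξ` carries the rational point `x₀` to a nearby rational point and, by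
  -- injectivity, another point of `C` to a nearby point different from `ξ`.
  have hlocal : ∀ ξ ∈ C, ∀ ε > 0, ∃ k : (Fin d → ℝ) → (Fin d → ℝ), Function.Injective k ∧
      MapsTo k C C ∧ MapsTo k (ratPoints d) (ratPoints d) ∧ (∃ u ∈ C, k u = ξ) ∧
      ∀ w ∈ C, ‖ξ - k w‖ < ε := fun ξ hξ ε hε => by
    have hr : 0 < ε / (distortion e * (R + 1)) := by positivity
    obtain ⟨ι, hι, k, ρ, h1, h2, h3, -⟩ := exists_pieces hf ht hs hτ hr
    obtain ⟨i, u, hu, rfl⟩ := mem_iUnion.1 (h3 C hC.2.2 hξ)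
    have hρ : 0 < ρ i := (lt_min one_pos (mul_pos ht hr)).trans_le (h1 i).1
    refine ⟨k i, (h1 i).2.2.injective hρ, h2 C hfC i, h2 _ hrat i, ⟨u, hu, rfl⟩, fun w hw => ?_⟩
    have h4 := (h1 i).2.2.norm_sub_le hρ.le u w
    have h5 : ‖u - w‖ ≤ R := by rw [← dist_eq_norm]; exact hR hu hw
    calc ‖k i u - k i w‖ ≤ distortion e * ρ i * ‖u - w‖ := h4
      _ ≤ distortion e * ρ i * R := by gcongr
      _ < distortion e * ρ i * (R + 1) := by gcongr; linarith
      _ ≤ distortion e * (ε / (distortion e * (R + 1))) * (R + 1) := by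
          gcongr
          exact (h1 i).2.1
      _ = ε := by field_simp
  refine ⟨hC.2.1, hC.1, fun ξ hξ ε hε => ?_, fun ξ hξ ε hε => ?_⟩
  · obtain ⟨k, -, hkC, hkr, -, hk⟩ := hlocal ξ hξ ε hε
    exact ⟨k x₀, hkC hx₀C, hkr hx₀, hk x₀ hx₀C⟩
  · obtain ⟨k, hki, hkC, -, ⟨u, hu, rfl⟩, hk⟩ := hlocal ξ hξ ε hε
    obtain ⟨w, hw, hne⟩ := hnt.exists_ne u
    exact ⟨k w, hkC hw, hki.ne hne, hk w hw⟩

end Intrinsic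

/-! ### Assembly of the two alternatives -/

theorem interior_eq_empty_of_no_segment {d : ℕ} {C : Set (Fin d → ℝ)} {v : Fin d → ℝ}
    (h : ¬ ContainsSegmentParallel C v) : interior C = ∅ := by
  rw [eq_empty_iff_forall_notMem]
  intro x hx
  obtain ⟨ε, hε, hball⟩ := Metric.mem_nhds_iff.1 (mem_interior_iff_mem_nhds.1 hx)
  have hv : 0 < ‖v‖ + 1 := by positivity
  refine h ⟨x, ε / (‖v‖ + 1), by positivity, subset_trans ?_ hball⟩
  refine (convex_ball x ε).segment_subset (Metric.mem_ball_self hε) ?_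
  rw [mem_ball_iff_norm, add_sub_cancel_left, norm_smul, Real.norm_of_nonneg (by positivity),
    div_mul_eq_mul_div, div_lt_iff₀ hv]
  nlinarith

/-- Both norms are transported along a linear equivalence, definitionally, so one argument serves
for either. -/
theorem isSim_refl_or_isSim_euclidean {d J : ℕ} {f : Fin J → (Fin d → ℝ) → (Fin d → ℝ)} {τ : Fin J → ℝ}
    (h : IsSimilarityIFS f τ) : (∀ j, IsSim (ContinuousLinearEquiv.refl ℝ _) (τ j) (f j)) ∨
      ∀ j, IsSim (EuclideanSpace.equiv (Fin d) ℝ) (τ j) (f j) :=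
  h.2

theorem intrinsic_extrinsic_approximation {d J : ℕ} [NeZero d] {E : Type*} [NormedAddCommGroup E]
    [NormedSpace ℝ E] {e : E ≃L[ℝ] (Fin d → ℝ)}
    {f : Fin J → (Fin d → ℝ) → (Fin d → ℝ)} {τ : Fin J → ℝ} (hf : ∀ j, IsSim e (τ j) (f j))
    (hτ : ∀ j, 0 < τ j ∧ τ j < 1) (hrat : IsRationalPreserving f)
    {C : Set (Fin d → ℝ)} (hC : IsAttractor f C)
    (hyp : (OpenSetCondition f ∧
        ∃ v : Fin d → ℤ, v ≠ 0 ∧ ¬ ContainsSegmentParallel C (fun i => (v i : ℝ))) ∨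
      similarityBound τ < 1 / 2) :
    EventuallyApprox C ∧ (C.Nontrivial → IsRationallyPerfect C) := by
  have : Nonempty (Fin J) := by
    obtain ⟨c, hc⟩ := hC.1
    rw [← hC.2.2] at hc
    obtain ⟨j, -⟩ := mem_iUnion.1 hc
    exact ⟨j⟩
  obtain ⟨jm, hjm⟩ := exists_eq_ciSup_of_finite (f := τ)
  obtain ⟨jn, hjn⟩ := Finite.exists_min τ
  set s := ⨆ j, τ j with hs
  have hs0 : 0 < s := hjm ▸ (hτ jm).1
  have hs1 : s < 1 := hjm ▸ (hτ jm).2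
  have hle : ∀ j, τ jn ≤ τ j ∧ τ j ≤ s := fun j =>
    ⟨hjn j, le_ciSup (finite_range τ).bddAbove j⟩
  refine ⟨?_, isRationallyPerfect_attractor hf (hτ jn).1 hs1 hle hrat hC⟩
  rcases hyp with ⟨⟨O, hOn, hO, hOb, hfO, hd⟩, v, -, hv⟩ | hD
  · obtain ⟨δ, hδ, hole⟩ := exists_hole hf (hτ jn).1 hs1 hle hC
      (interior_eq_empty_of_no_segment hv) hO hOn hOb (fun j => mapsTo_iff_image_subset.2 (hfO j)) hd
    exact eventuallyApprox_of_holes hδ hole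
  · exact eventuallyApprox_of_bound_lt hf hs0 hs1 (fun j => ⟨(hτ j).1.le, (hle j).2⟩) hC hD

end CantorApprox

end

theorem theorem3p5 {d J : ℕ} (hd : 1 ≤ d)
    (f : Fin J → (Fin d → ℝ) → (Fin d → ℝ)) (τ : Fin J → ℝ)
    (hsim : CantorApprox.IsSimilarityIFS f τ)
    (hrat : CantorApprox.IsRationalPreserving f)
    (C : Set (Fin d → ℝ)) (hC : CantorApprox.IsAttractor f C)
    (hyp : (CantorApprox.OpenSetCondition f ∧
        ∃ v : Fin d → ℤ, v ≠ 0 ∧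
          ¬ CantorApprox.ContainsSegmentParallel C (fun i => (v i : ℝ))) ∨
      CantorApprox.similarityBound τ < 1 / 2) :
    -- uniform extrinsic approximation of order `K / Q`
    (∃ K : ℝ, 0 < K ∧ ∀ ξ ∈ C, ∀ Q : ℝ, 1 < Q →
      ∃ (p : Fin d → ℤ) (q : ℕ), 1 ≤ q ∧ (q : ℝ) ≤ Q ∧
        CantorApprox.ratVec p q ∉ C ∧ ‖ξ - CantorApprox.ratVec p q‖ ≤ K / Q) ∧
    -- the remaining claims concern attractors with more than one point
    (C.Nontrivial →
      -- the order `K / Q` cannot be improved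
      (∀ Φ : ℕ → ℝ, (∀ n, 0 < Φ n) → Tendsto Φ atTop (𝓝 0) →
        ∃ ξ ∈ C, ξ ∉ CantorApprox.ratPoints d ∧
          ∃ᶠ Q : ℕ in atTop, ∀ (p : Fin d → ℤ) (q : ℕ), 1 ≤ q → q ≤ Q →
            CantorApprox.ratVec p q ∉ C →
              ‖ξ - CantorApprox.ratVec p q‖ > Φ Q / (Q : ℝ)) ∧
      -- intrinsically well approximable vectors of every order
      (∀ Ψ : ℕ → ℝ, (∀ n, 0 < Ψ n) →
        ∃ ξ, CantorApprox.IntrinsicallyApproximable C Ψ ξ) ∧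
      ∃ ξ ∈ C, CantorApprox.IsLiouvilleVector ξ) := by
  have : NeZero d := ⟨by omega⟩
  obtain ⟨happ, hperf⟩ : CantorApprox.EventuallyApprox C ∧
      (C.Nontrivial → CantorApprox.IsRationallyPerfect C) := by
    rcases CantorApprox.isSim_refl_or_isSim_euclidean hsim with h | h
    · exact CantorApprox.intrinsic_extrinsic_approximation h hsim.1 hrat hC hyp
    · exact CantorApprox.intrinsic_extrinsic_approximation h hsim.1 hrat hC hyp
  exact ⟨happ.uniform hC.2.1, fun hnt => ⟨fun Φ _ hΦ => (hperf hnt).exists_badly_extrinsic hΦ,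
    fun Ψ hΨ => (hperf hnt).exists_intrinsicallyApproximable hΨ,
    (hperf hnt).exists_isLiouvilleVector⟩⟩
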